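/- Notation: for complex $a,q$ with $|q|<1$ put $(a;q)_n=\prod_{j=0}^{n-1}(1-aq^j)$ for integers $n\ge 0$, $(a;q)_\infty=\prod_{j\ge 0}(1-aq^j)$, and $(a_1,\dots,a_m;q)_\infty=(a_1;q)_\infty\cdots(a_m;q)_\infty$; moreover $1/(q;q)_n=0$ for negative integers $n$. Let $q,a\in\mathbb{C}$ with $|q|<1$, $a\neq 0$, and $a\neq q^m$ for every $m\in\mathbb{Z}$. For every positive integer $k$, with $\kappa=2k+1$ and $N_j=n_j+n_{j+1}+\cdots+n_{k-1}$ (so that $N_1=0$ and the multisum has the single term $1/(q;q)_n$ when $k=1$), all the infinite series below converge absolutely, and $$\sum_{n=0}^{\infty}\frac{(q;q)_{2n}\,q^n}{(a;q)_{n+1}(q/a;q)_n}\sum_{n_1,\dots,n_{k-1}=0}^{\infty}\frac{q^{N_1^2+\cdots+N_{k-1}^2+N_1+\cdots+N_{k-1}}}{(q;q)_{n-N_1}(q;q)_{n_1}\cdots(q;q)_{n_{k-1}}}$$ $$=\sum_{n=0}^{\infty}a^nq^{kn(n+1)}+\sum_{i=1}^{\kappa-1}(-1)^{i+1}a^iq^{\binom{i}{2}}\frac{(q^i,q^{\kappa-i},q^{\kappa};q^{\kappa})_\infty}{(q,a,q/a;q)_\infty}\sum_{n=0}^{\infty}a^{\kappa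 n}q^{kn(\kappa n+2i)}.$$ The case $k=1$ is Ramanujan's identity (again with all series absolutely convergent) $$\sum_{n=0}^{\infty}\frac{(q^{n+1};q)_n\,q^n}{(a;q)_{n+1}(q/a;q)_n}=\sum_{n=0}^{\infty}a^nq^{n(n+1)}+\sum_{n=0}^{\infty}\frac{a^{3n+1}q^{n(3n+2)}(1-aq^{2n+1})}{(a,q/a;q)_\infty}.$$ -/

import Mathlib

/-- The finite `q`-shifted factorial `(a;q)_n = ∏_{j=0}^{n-1} (1 - a q^j)`, for `n ≥ 0`. -/
noncomputable def qPoch (a q : ℂ) (n : ℕ) : ℂ :=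
  ∏ j ∈ Finset.range n, (1 - a * q ^ j)

/-- The infinite `q`-shifted factorial `(a;q)_∞ = ∏_{j ≥ 0} (1 - a q^j)`. -/
noncomputable def qPochInf (a q : ℂ) : ℂ :=
  ∏' j : ℕ, (1 - a * q ^ j)

/-- The product `(a, b, c; q)_∞ = (a;q)_∞ (b;q)_∞ (c;q)_∞`. -/
noncomputable def qPochInf₃ (a b c q : ℂ) : ℂ :=
  qPochInf a q * qPochInf b q * qPochInf c q

/-- The reciprocal `1/(q;q)_m` for an integer `m`, which is `0` for negative `m`. For `q ≠ 0`
this is `(q^{m+1};q)_∞ / (q;q)_∞`, see `qFacInv_eq_div`. -/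
noncomputable def qFacInv (q : ℂ) (m : ℤ) : ℂ :=
  if m < 0 then 0 else 1 / qPoch q q m.toNat

/-- The partial sums of a tuple `ν = (n_1, …, n_{k-1})`, whose entry `n_{i+1}` is `ν i`: the value
at `j` is `N_{j+1} = n_{j+1} + n_{j+2} + ⋯ + n_{k-1}`. In particular `tailSum ν 0` is `N_1`
(an empty sum, hence `0`, for `k = 1`). -/
def tailSum {m : ℕ} (ν : Fin m → ℕ) (j : ℕ) : ℕ :=
  ∑ i : Fin m with j ≤ i.val, ν i

/-- The summand of the `(k-1)`-fold sum over `ν = (n_1, …, n_{k-1})`: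
`q^{N_1^2 + ⋯ + N_{k-1}^2 + N_1 + ⋯ + N_{k-1}} / ((q;q)_{n-N_1} (q;q)_{n_1} ⋯ (q;q)_{n_{k-1}})`. -/
noncomputable def multisumTerm (k : ℕ) (q : ℂ) (n : ℕ) (ν : Fin (k - 1) → ℕ) : ℂ :=
  q ^ ((∑ j : Fin (k - 1), tailSum ν j ^ 2) + ∑ j : Fin (k - 1), tailSum ν j)
    * qFacInv q ((n : ℤ) - (tailSum ν 0 : ℤ))
    * ∏ j : Fin (k - 1), (1 / qPoch q q (ν j))

/-- For `|q| < 1` the product defining `(a;q)_∞` converges. -/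
theorem multipliable_qPochInf {q : ℂ} (hq : ‖q‖ < 1) (a : ℂ) :
    Multipliable fun j : ℕ => 1 - a * q ^ j := by
  have h : Summable fun j : ℕ => ‖-(a * q ^ j)‖ := by
    simp only [norm_neg, norm_mul, norm_pow]
    exact (summable_geometric_of_lt_one (norm_nonneg q) hq).mul_left _
  simpa [sub_eq_add_neg] using multipliable_one_add_of_summable h

theorem qPochInf_eq_mul {q : ℂ} (hq : ‖q‖ < 1) (a : ℂ) (m : ℕ) :
    qPochInf a q = qPoch a q m * qPochInf (a * q ^ m) q := by
  induction m with
  | zero => simp [qPoch]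
  | succ m ih =>
    have h : qPochInf (a * q ^ m) q = (1 - a * q ^ m) * qPochInf (a * q ^ (m + 1)) q := by
      have e : ∀ j : ℕ, a * q ^ m * q ^ (j + 1) = a * q ^ (m + 1) * q ^ j := fun j => by ring
      have hm : Multipliable fun j : ℕ => 1 - a * q ^ m * q ^ (j + 1) := by
        simpa only [e] using multipliable_qPochInf hq (a * q ^ (m + 1))
      have hp := tprod_eq_zero_mul' (f := fun j : ℕ => 1 - a * q ^ m * q ^ j) hm
      simp only [e, pow_zero, mul_one] at hp
      simpa only [qPochInf] using hp
    rw [ih, h, qPoch, qPoch, Finset.prod_range_succ, mul_assoc]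

/-- The reciprocal `1/(q;q)_m` agrees with the definition `(a;q)_m = (a;q)_∞ / (a q^m;q)_∞` of
the `q`-shifted factorial for all integers `m`. -/
theorem qFacInv_eq_div {q : ℂ} (hq : ‖q‖ < 1) (hq0 : q ≠ 0) (m : ℤ) :
    qFacInv q m = qPochInf (q * q ^ m) q / qPochInf q q := by
  rcases lt_or_ge m 0 with hm | hm
  · rw [qFacInv, if_pos hm]
    obtain ⟨r, rfl⟩ : ∃ r : ℕ, m = -((r : ℤ) + 1) := ⟨(-m - 1).toNat, by omega⟩
    have hz : q * q ^ (-((r : ℤ) + 1)) * q ^ r = 1 := by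
      rw [neg_add, zpow_add₀ hq0, zpow_neg, zpow_neg, zpow_natCast, zpow_one]
      field_simp
    rw [qPochInf_eq_mul hq (q * q ^ (-((r : ℤ) + 1))) (r + 1), qPoch, Finset.prod_range_succ, hz]
    simp
  · obtain ⟨r, rfl⟩ := Int.eq_ofNat_of_zero_le hm
    have hne : qPochInf q q ≠ 0 := by
      have h1 : ∀ j : ℕ, 1 + -(q * q ^ j) ≠ 0 := fun j h => by
        have h2 : q ^ (j + 1) = 1 := by linear_combination -h
        have h3 : ‖q‖ ^ (j + 1) < 1 := pow_lt_one₀ (norm_nonneg q) hq (Nat.succ_ne_zero j)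
        rw [← norm_pow, h2, norm_one] at h3
        exact lt_irrefl _ h3
      have h : Summable fun j : ℕ => ‖-(q * q ^ j)‖ := by
        simp only [norm_neg, norm_mul, norm_pow]
        exact (summable_geometric_of_lt_one (norm_nonneg q) hq).mul_left _
      simpa only [qPochInf, sub_eq_add_neg] using tprod_one_add_ne_zero_of_summable h1 h
    have h := qPochInf_eq_mul hq q r
    have hp : qPoch q q r ≠ 0 := fun h0 => hne (by rw [h, h0, zero_mul])
    rw [qFacInv, if_neg (not_lt.mpr hm), Int.toNat_natCast, zpow_natCast,
      div_eq_div_iff hp hne, one_mul, h, mul_comm]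

open Filter Topology Finset

/-! The identity comes from pairing a Bailey pair with a conjugate Bailey sequence. Start from the
pair with `β_n = 1` at `n = 0` and `0` elsewhere (`baileyBeta_zero`). Each Bailey-lemma step
(`baileyBeta_succ`) multiplies the `r`-th coefficient by `q^{r(r+1)}` and adds one summation to
`β_n`; after `k` steps `β_n` is the multisum (`tsum_multisumTerm`).

Interchanging summations turns the left side into a sum over `r` of Bailey coefficients times `γ_r`
(`hasSum_deltaSeq_mul_baileyBeta`). By telescoping, `(1 - q^{2r+1}) γ_r` satisfies an inhomogeneous
second-order recurrence. A difference of two partial theta functions, divided by `θ = (q, a, q/a;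
q)_∞`, satisfies the same one, and a bounded solution is unique (`gammaSeq_eq`).

By the Jacobi triple product, `θ` is a bilateral theta series, and the partial thetas are its upper
and lower tails. Replacing each lower tail by `θ` minus an upper tail produces `θ ∑ a^n q^{kn(n+1)}`
minus a double theta series (`tsum_mul_sub_tsum_doubleThetaSum`). The inner sums of the latter are
theta series in base `q^{2k+1}`. Sorting the outer index by residue modulo `2k+1` and applying the
triple product again gives the products on the right (`tsum_doubleThetaSum`). The value `q = 0` is
checked directly. -/

/-! ### Limits, bounds and reciprocals of `q`-factorials. -/

theorem qPoch_zero (a q : ℂ) : qPoch a q 0 = 1 := by simp [qPoch]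

theorem qPoch_succ (a q : ℂ) (n : ℕ) : qPoch a q (n + 1) = qPoch a q n * (1 - a * q ^ n) := by
  rw [qPoch, qPoch, Finset.prod_range_succ]

theorem tendsto_qPoch {q : ℂ} (hq : ‖q‖ < 1) (a : ℂ) :
    Tendsto (qPoch a q) atTop (𝓝 (qPochInf a q)) :=
  (multipliable_qPochInf hq a).hasProd.tendsto_prod_nat

theorem qPochInf_ne_zero {q : ℂ} (hq : ‖q‖ < 1) {a : ℂ} (h : ∀ j : ℕ, a * q ^ j ≠ 1) :
    qPochInf a q ≠ 0 := by
  have h1 : ∀ j : ℕ, 1 + -(a * q ^ j) ≠ 0 := fun j h0 => h j (by linear_combination -h0)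
  have h2 : Summable fun j : ℕ => ‖-(a * q ^ j)‖ := by
    simp only [norm_neg, norm_mul, norm_pow]
    exact (summable_geometric_of_lt_one (norm_nonneg q) hq).mul_left _
  simpa only [qPochInf, sub_eq_add_neg] using tprod_one_add_ne_zero_of_summable h1 h2

theorem qPoch_ne_zero {q a : ℂ} (h : ∀ j : ℕ, a * q ^ j ≠ 1) (n : ℕ) : qPoch a q n ≠ 0 :=
  Finset.prod_ne_zero_iff.mpr fun j _ => sub_ne_zero.mpr (h j).symm

theorem self_mul_pow_ne_one {q : ℂ} (hq : ‖q‖ < 1) (j : ℕ) : q * q ^ j ≠ 1 := fun h => by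
  have h3 : ‖q‖ ^ (j + 1) < 1 := pow_lt_one₀ (norm_nonneg q) hq (Nat.succ_ne_zero j)
  rw [← norm_pow, pow_succ', h, norm_one] at h3
  exact lt_irrefl _ h3

theorem qPoch_self_ne_zero {q : ℂ} (hq : ‖q‖ < 1) (n : ℕ) : qPoch q q n ≠ 0 :=
  qPoch_ne_zero (self_mul_pow_ne_one hq) n

theorem qPochInf_self_ne_zero {q : ℂ} (hq : ‖q‖ < 1) : qPochInf q q ≠ 0 :=
  qPochInf_ne_zero hq (self_mul_pow_ne_one hq)

theorem qFacInv_natCast (q : ℂ) (n : ℕ) : qFacInv q n = 1 / qPoch q q n := by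
  simp [qFacInv]

theorem qFacInv_of_neg (q : ℂ) {m : ℤ} (hm : m < 0) : qFacInv q m = 0 := by
  simp [qFacInv, hm]

theorem qFacInv_zero (q : ℂ) : qFacInv q 0 = 1 := by
  simp [qFacInv, qPoch_zero]

/-- No sign condition on `m` is needed: at `m = 0` the factor `1 - q^0` vanishes together with
`1/(q;q)_{-1}`. Recurrences can therefore be used across the boundary of a summation range. -/
theorem qFacInv_sub_one {q : ℂ} (hq : ‖q‖ < 1) (m : ℤ) :
    qFacInv q (m - 1) = (1 - q ^ m) * qFacInv q m := by
  rcases lt_trichotomy m 0 with hm | rfl | hm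
  · rw [qFacInv_of_neg q hm, qFacInv_of_neg q (by omega), mul_zero]
  · rw [qFacInv_of_neg q (by omega)]; simp
  · obtain ⟨n, rfl⟩ : ∃ n : ℕ, m = (n + 1 : ℕ) := ⟨(m - 1).toNat, by omega⟩
    have h1 : ((n + 1 : ℕ) : ℤ) - 1 = n := by push_cast; ring
    have h2 := qPoch_self_ne_zero hq (n + 1)
    rw [h1, qFacInv_natCast, qFacInv_natCast, zpow_natCast]
    rw [qPoch_succ] at h2 ⊢
    have h3 := left_ne_zero_of_mul h2
    have h4 := right_ne_zero_of_mul h2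
    rw [← pow_succ'] at h4 ⊢
    field_simp

theorem exists_norm_le_of_tendsto {f : ℕ → ℂ} {l : ℂ} (h : Tendsto f atTop (𝓝 l)) :
    ∃ C, 0 < C ∧ ∀ n, ‖f n‖ ≤ C := by
  obtain ⟨C, hC⟩ := (Metric.isBounded_range_of_tendsto f h).exists_norm_le
  exact ⟨max C 1, by positivity, fun n => (hC _ ⟨n, rfl⟩).trans (le_max_left _ _)⟩

theorem tendsto_qFacInv_natCast {q : ℂ} (hq : ‖q‖ < 1) :
    Tendsto (fun n : ℕ => qFacInv q n) atTop (𝓝 (1 / qPochInf q q)) := by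
  simp only [qFacInv_natCast]
  exact tendsto_const_nhds.div (tendsto_qPoch hq q) (qPochInf_self_ne_zero hq)

theorem tendsto_qFacInv {q : ℂ} (hq : ‖q‖ < 1) :
    Tendsto (fun m : ℤ => qFacInv q m) atTop (𝓝 (1 / qPochInf q q)) := by
  have h : Tendsto (fun m : ℤ => qFacInv q (m.toNat : ℤ)) atTop (𝓝 (1 / qPochInf q q)) :=
    (tendsto_qFacInv_natCast hq).comp (tendsto_atTop_atTop.mpr fun b => ⟨b, fun a h => by omega⟩)
  refine h.congr' ?_
  filter_upwards [eventually_ge_atTop 0] with m hm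
  rw [Int.toNat_of_nonneg hm]

theorem tendsto_qFacInv_natCast_add {q : ℂ} (hq : ‖q‖ < 1) (c : ℤ) :
    Tendsto (fun n : ℕ => qFacInv q (n + c)) atTop (𝓝 (1 / qPochInf q q)) :=
  (tendsto_qFacInv hq).comp
    (tendsto_atTop_add_const_right _ _ tendsto_natCast_atTop_atTop)

theorem exists_norm_qFacInv_le {q : ℂ} (hq : ‖q‖ < 1) :
    ∃ C, 0 < C ∧ ∀ m, ‖qFacInv q m‖ ≤ C := by
  obtain ⟨C, hC0, hC⟩ := exists_norm_le_of_tendsto (tendsto_qFacInv_natCast hq)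
  refine ⟨C, hC0, fun m => ?_⟩
  rcases lt_or_ge m 0 with hm | hm
  · rw [qFacInv_of_neg q hm, norm_zero]; exact hC0.le
  · rw [← Int.toNat_of_nonneg hm]; exact hC _

/-! ### The Bailey pair, by iterating the Bailey lemma. -/

/-- The `q`-Chu–Vandermonde sum behind the Bailey lemma. -/
theorem sum_qFacInv_vandermonde {q : ℂ} (hq : ‖q‖ < 1) (hq0 : q ≠ 0) (M c : ℕ) :
    ∑ m ∈ range (M + 1), q ^ (m * (m + c)) * qFacInv q ((M : ℤ) - m) * qFacInv q m
        * qFacInv q (m + c : ℤ)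
      = qFacInv q M * qFacInv q (M + c : ℤ) := by
  induction M generalizing c with
  | zero => simp [qFacInv_zero]
  | succ M ih =>
    have hM : (1 - q ^ (M + 1)) ≠ 0 := by
      have := self_mul_pow_ne_one hq M
      rw [← pow_succ'] at this
      exact sub_ne_zero.mpr this.symm
    apply mul_left_cancel₀ hM
    -- Write `1 - q^{M+1} = (1 - q^{M+1-m}) + q^{M+1-m} (1 - q^m)`; each piece lowers the index of
    -- one reciprocal factorial. The first sum is the case `(M, c)`, and the second, after shifting
    -- `m`, is the case `(M, c+1)`.
    have key : ∀ m ∈ range (M + 1 + 1), (1 - q ^ (M + 1)) *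
        (q ^ (m * (m + c)) * qFacInv q (((M + 1 : ℕ) : ℤ) - m) * qFacInv q m
          * qFacInv q (m + c : ℤ))
        = q ^ (m * (m + c)) * qFacInv q ((M : ℤ) - m) * qFacInv q m * qFacInv q (m + c : ℤ)
        + q ^ (m * (m + c)) * q ^ ((M : ℤ) + 1 - m) * qFacInv q ((M : ℤ) + 1 - m)
          * qFacInv q ((m : ℤ) - 1) * qFacInv q (m + c : ℤ) := by
      intro m _
      have e1 : (M : ℤ) - m = (M + 1 - m) - 1 := by ring
      rw [e1, qFacInv_sub_one hq, qFacInv_sub_one hq]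
      push_cast
      have e2 : q ^ (M + 1) = q ^ ((M : ℤ) + 1 - m) * q ^ (m : ℤ) := by
        rw [← zpow_add₀ hq0]
        have : (M : ℤ) + 1 - m + m = (M + 1 : ℕ) := by push_cast; ring
        rw [this, zpow_natCast]
      rw [e2]; ring
    rw [mul_sum, sum_congr rfl key, sum_add_distrib, sum_range_succ, ih c, sum_range_succ']
    have s2 : ∑ m ∈ range (M + 1), q ^ ((m + 1) * (m + 1 + c)) * q ^ ((M : ℤ) + 1 - (m + 1 : ℕ))
          * qFacInv q ((M : ℤ) + 1 - (m + 1 : ℕ))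
          * qFacInv q (((m + 1 : ℕ) : ℤ) - 1) * qFacInv q ((m + 1 : ℕ) + c : ℤ)
        = q ^ (M + 1 + c) * ∑ m ∈ range (M + 1), q ^ (m * (m + (c + 1 : ℕ)))
          * qFacInv q ((M : ℤ) - m) * qFacInv q m * qFacInv q (m + (c + 1 : ℕ) : ℤ) := by
      rw [mul_sum]
      refine sum_congr rfl fun m hm => ?_
      have hm' : m ≤ M := by simpa [Nat.lt_succ_iff] using hm
      have e1 : (M : ℤ) + 1 - (m + 1 : ℕ) = (M - m : ℕ) := by omega
      have e1' : (M : ℤ) - m = (M - m : ℕ) := by omega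
      have e2 : ((m + 1 : ℕ) : ℤ) - 1 = m := by omega
      have e3 : (((m + 1 : ℕ) : ℤ) + c) = m + (c + 1 : ℕ) := by omega
      have e4 : q ^ ((m + 1) * (m + 1 + c)) * q ^ (M - m)
          = q ^ (M + 1 + c) * q ^ (m * (m + (c + 1))) := by
        rw [← pow_add, ← pow_add]
        congr 1
        obtain ⟨d, rfl⟩ := Nat.exists_eq_add_of_le hm'
        rw [Nat.add_sub_cancel_left]; ring
      rw [e1, e1', e2, e3, zpow_natCast, e4]; ring
    rw [s2, ih (c + 1)]
    have z1 : qFacInv q ((M : ℤ) - (M + 1 : ℕ)) = 0 := qFacInv_of_neg q (by push_cast; omega)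
    have z2 : qFacInv q (((0 : ℕ) : ℤ) - 1) = 0 := qFacInv_of_neg q (by simp)
    rw [z1, z2]
    have f1 : qFacInv q M = (1 - q ^ (M + 1)) * qFacInv q (M + 1 : ℕ) := by
      have := qFacInv_sub_one hq ((M + 1 : ℕ) : ℤ)
      rwa [zpow_natCast, show (((M + 1 : ℕ) : ℤ) - 1) = M by push_cast; ring] at this
    have f2 : qFacInv q (M + c : ℤ) = (1 - q ^ (M + 1 + c)) * qFacInv q ((M + 1 : ℕ) + c : ℤ) := by
      have := qFacInv_sub_one hq ((M + 1 + c : ℕ) : ℤ)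
      rwa [zpow_natCast, show (((M + 1 + c : ℕ) : ℤ) - 1) = M + c by push_cast; ring,
        show ((M + 1 + c : ℕ) : ℤ) = (M + 1 : ℕ) + c by push_cast; ring] at this
    rw [show (M : ℤ) + (c + 1 : ℕ) = (M + 1 : ℕ) + c by push_cast; ring, f1, f2]
    ring

/-- The term `α_r q^{k r(r+1)} / ((q)_{n-r} (q)_{n+r+1})` of the Bailey pair with
`α_r = (-1)^r q^{r(r-1)/2} (1 - q^{2r+1})`. -/
noncomputable def baileyTerm (k : ℕ) (q : ℂ) (n r : ℕ) : ℂ :=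
  (-1) ^ r * q ^ (k * (r * (r + 1)) + r.choose 2) * (1 - q ^ (2 * r + 1))
    * qFacInv q ((n : ℤ) - r) * qFacInv q (n + r + 1 : ℤ)

/-- The sequence `β_n` of the `k`-th Bailey pair. -/
noncomputable def baileyBeta (k : ℕ) (q : ℂ) (n : ℕ) : ℂ :=
  ∑ r ∈ range (n + 1), baileyTerm k q n r

/-- For `n > 0` the defining sum, multiplied by `1 - q^n`, telescopes, and both boundary terms
vanish. -/
theorem baileyBeta_zero {q : ℂ} (hq : ‖q‖ < 1) (hq0 : q ≠ 0) (n : ℕ) :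
    baileyBeta 0 q n = if n = 0 then 1 else 0 := by
  rcases Nat.eq_zero_or_pos n with rfl | hn
  · have := qFacInv_sub_one hq 1
    simp [qFacInv_zero] at this
    simpa [baileyBeta, baileyTerm, qFacInv_zero] using this.symm
  · rw [if_neg hn.ne']
    have hM : (1 - q ^ n) ≠ 0 := by
      have := self_mul_pow_ne_one hq (n - 1)
      rw [← pow_succ', Nat.sub_add_cancel hn] at this
      exact sub_ne_zero.mpr this.symm
    apply mul_left_cancel₀ hM
    -- The telescoping certificate: `1 - q^r` kills it at `r = 0`, and `1/(q;q)_{n-r}` kills it at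
    -- `r = n + 1`.
    let U : ℕ → ℂ := fun r => (-1) ^ r * q ^ (r.choose 2) * (1 - q ^ r)
      * qFacInv q ((n : ℤ) - r) * qFacInv q (n + r : ℤ)
    have key : ∀ r, (1 - q ^ n) * baileyTerm 0 q n r = U r - U (r + 1) := by
      intro r
      simp only [baileyTerm, U]
      have e1 : (n : ℤ) - (r + 1 : ℕ) = (n - r) - 1 := by push_cast; ring
      have e2 : (n : ℤ) + (r + 1 : ℕ) = n + r + 1 := by push_cast; ring
      have e3 : qFacInv q (n + r : ℤ) = (1 - q ^ (n + r + 1 : ℤ)) * qFacInv q (n + r + 1 : ℤ) := by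
        rw [← qFacInv_sub_one hq, add_sub_cancel_right]
      rw [e1, qFacInv_sub_one hq, e2, e3, zpow_sub₀ hq0, zpow_add₀ hq0, zpow_add₀ hq0, Nat.choose_succ_succ' r 1,
        Nat.choose_one_right]
      simp only [zpow_natCast, zpow_one, zero_mul, zero_add, pow_add, pow_mul', pow_one]
      have := pow_ne_zero r hq0
      field_simp
      ring
    rw [baileyBeta, mul_sum, sum_congr rfl fun r _ => key r, sum_range_sub', mul_zero]
    have z1 : qFacInv q ((n : ℤ) - (n + 1 : ℕ)) = 0 := qFacInv_of_neg q (by push_cast; omega)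
    simp only [U, z1]
    simp

/-- The Bailey lemma with both free parameters sent to infinity. After the sums over `s` and `r` are
exchanged, the inner sum over `s = r + m` is `sum_qFacInv_vandermonde` with `c = 2r + 1`. -/
theorem baileyBeta_succ {q : ℂ} (hq : ‖q‖ < 1) (hq0 : q ≠ 0) (k n : ℕ) :
    baileyBeta (k + 1) q n
      = ∑ s ∈ range (n + 1), q ^ (s ^ 2 + s) * qFacInv q ((n : ℤ) - s) * baileyBeta k q s := by
  have ext : ∀ s ∈ range (n + 1), q ^ (s ^ 2 + s) * qFacInv q ((n : ℤ) - s) * baileyBeta k q s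
      = ∑ r ∈ range (n + 1), q ^ (s ^ 2 + s) * qFacInv q ((n : ℤ) - s) * baileyTerm k q s r := by
    intro s hs
    rw [baileyBeta, mul_sum]
    apply sum_subset (range_mono (by simpa using hs))
    intro r _ hr
    have : qFacInv q ((s : ℤ) - r) = 0 := qFacInv_of_neg q (by simp at hr; omega)
    simp [baileyTerm, this]
  rw [sum_congr rfl ext, sum_comm, baileyBeta]
  refine sum_congr rfl fun r hr => ?_
  have hr' : r ≤ n := by simpa [Nat.lt_succ_iff] using hr
  obtain ⟨M, rfl⟩ := Nat.exists_eq_add_of_le hr'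
  rw [show r + M + 1 = r + (M + 1) by ring, sum_range_add]
  have z : ∑ s ∈ range r, q ^ (s ^ 2 + s) * qFacInv q (((r + M : ℕ) : ℤ) - s) * baileyTerm k q s r
      = 0 := by
    refine sum_eq_zero fun s hs => ?_
    have : qFacInv q ((s : ℤ) - r) = 0 := qFacInv_of_neg q (by simp at hs; omega)
    simp [baileyTerm, this]
  have v := sum_qFacInv_vandermonde hq hq0 M (2 * r + 1)
  have e1 : ((r + M : ℕ) : ℤ) - r = M := by push_cast; ring
  have e2 : ((r + M : ℕ) : ℤ) + r + 1 = M + (2 * r + 1 : ℕ) := by push_cast; ring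
  rw [z, zero_add, baileyTerm, e1, e2, mul_assoc _ (qFacInv q (M : ℤ)), ← v, mul_sum]
  refine sum_congr rfl fun m _ => ?_
  have e3 : ((r + M : ℕ) : ℤ) - (r + m : ℕ) = M - m := by push_cast; ring
  have e4 : ((r + m : ℕ) : ℤ) - r = m := by push_cast; ring
  have e5 : ((r + m : ℕ) : ℤ) + r + 1 = m + (2 * r + 1 : ℕ) := by push_cast; ring
  rw [baileyTerm, e3, e4, e5]
  have e6 : (r + m) ^ 2 + (r + m) + (k * (r * (r + 1)) + r.choose 2)
      = (k + 1) * (r * (r + 1)) + r.choose 2 + m * (m + (2 * r + 1)) := by ring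
  have e7 : q ^ ((r + m) ^ 2 + (r + m)) * q ^ (k * (r * (r + 1)) + r.choose 2)
      = q ^ ((k + 1) * (r * (r + 1)) + r.choose 2) * q ^ (m * (m + (2 * r + 1))) := by
    rw [← pow_add, ← pow_add, e6]
  linear_combination (qFacInv q ((M : ℤ) - m) * (-1) ^ r * (1 - q ^ (2 * r + 1)) * qFacInv q m
    * qFacInv q (m + (2 * r + 1 : ℕ) : ℤ)) * e7

/-! ### The multisum as a Bailey sequence. -/

theorem tailSum_cons_zero {m : ℕ} (s : ℕ) (ν : Fin m → ℕ) :
    tailSum (Fin.cons s ν : Fin (m + 1) → ℕ) 0 = s + tailSum ν 0 := by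
  simp [tailSum, Fin.sum_univ_succ]

theorem tailSum_cons_succ {m : ℕ} (s : ℕ) (ν : Fin m → ℕ) (j : ℕ) :
    tailSum (Fin.cons s ν : Fin (m + 1) → ℕ) (j + 1) = tailSum ν j := by
  simp [tailSum, Finset.sum_filter, Fin.sum_univ_succ]

theorem le_tailSum_zero {m : ℕ} (ν : Fin m → ℕ) (i : Fin m) : ν i ≤ tailSum ν 0 := by
  simp only [tailSum, Nat.zero_le, Finset.filter_true]
  exact Finset.single_le_sum (f := ν) (fun _ _ => Nat.zero_le _) (Finset.mem_univ i)

theorem finite_tailSum_le {m : ℕ} (n : ℕ) : {ν : Fin m → ℕ | tailSum ν 0 ≤ n}.Finite := by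
  exact (Set.finite_Iic (fun _ : Fin m => n)).subset fun ν hν i => (le_tailSum_zero ν i).trans hν

theorem multisumTerm_eq_zero {k : ℕ} (q : ℂ) {n : ℕ} {ν : Fin (k - 1) → ℕ}
    (h : n < tailSum ν 0) : multisumTerm k q n ν = 0 := by
  rw [multisumTerm, qFacInv_of_neg q (by omega)]; simp

theorem summable_multisumTerm (k : ℕ) (q : ℂ) (n : ℕ) : Summable (multisumTerm k q n) := by
  refine summable_of_hasFiniteSupport ((finite_tailSum_le n).subset fun ν hν => ?_)
  by_contra h
  exact hν (multisumTerm_eq_zero q (not_le.mp h))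

theorem multisumTerm_succ (m : ℕ) (q : ℂ) (n : ℕ) (ν : Fin m → ℕ) :
    multisumTerm (m + 1) q n ν
      = q ^ ((∑ j : Fin m, tailSum ν j ^ 2) + ∑ j : Fin m, tailSum ν j)
        * qFacInv q ((n : ℤ) - (tailSum ν 0 : ℤ)) * ∏ j : Fin m, (1 / qPoch q q (ν j)) := rfl

theorem multisumTerm_cons (m : ℕ) (q : ℂ) (n s : ℕ) (ν : Fin m → ℕ) :
    multisumTerm (m + 1 + 1) q n (Fin.cons s ν : Fin (m + 1) → ℕ)
      = q ^ ((s + tailSum ν 0) ^ 2 + (s + tailSum ν 0))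
        * qFacInv q ((n : ℤ) - (s + tailSum ν 0 : ℕ))
        * multisumTerm (m + 1) q (s + tailSum ν 0) ν := by
  have e : (((s + tailSum ν 0 : ℕ) : ℤ) - (tailSum ν 0 : ℤ)) = s := by push_cast; ring
  rw [multisumTerm_succ, multisumTerm_succ]
  simp only [tailSum_cons_zero, Fin.sum_univ_succ,
    Fin.prod_univ_succ, Fin.val_zero, Fin.val_succ, tailSum_cons_succ, Fin.cons_zero, Fin.cons_succ,
    e, qFacInv_natCast, pow_add]
  ring

/-- Replace `n_1` by `s = N_1 = n_1 + N_2` and keep the other indices. The map is injective, and the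
pairs it misses, those with `s < N_2`, contribute zero because `1/(q;q)_{s-N_2} = 0`. So `s` can
range freely, and the rest is the multisum one level lower. -/
theorem tsum_multisumTerm_succ (m : ℕ) (q : ℂ) (n : ℕ) :
    ∑' ν, multisumTerm (m + 1 + 1) q n ν
      = ∑ s ∈ range (n + 1), q ^ (s ^ 2 + s) * qFacInv q ((n : ℤ) - s)
          * ∑' ν, multisumTerm (m + 1) q s ν := by
  let g : ℕ × (Fin m → ℕ) → ℂ := fun p =>
    q ^ (p.1 ^ 2 + p.1) * qFacInv q ((n : ℤ) - p.1) * multisumTerm (m + 1) q p.1 p.2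
  let φ : ℕ × (Fin m → ℕ) → ℕ × (Fin m → ℕ) := fun p => (p.1 + tailSum p.2 0, p.2)
  have hφ : Function.Injective φ := by
    rintro ⟨s, ν⟩ ⟨s', ν'⟩ h
    simp only [φ, Prod.mk.injEq] at h
    obtain ⟨h1, rfl⟩ := h
    simpa using h1
  have hsupp : ∀ p ∉ Set.range φ, g p = 0 := by
    rintro ⟨s, ν⟩ h
    have : s < tailSum ν 0 := by
      by_contra hlt
      exact h ⟨(s - tailSum ν 0, ν), by simp only [φ, Prod.mk.injEq, and_true]; omega⟩
    simp only [g]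
    rw [multisumTerm_eq_zero q (by exact this), mul_zero]
  have hn : ∀ s : ℕ, n < s → qFacInv q ((n : ℤ) - s) = 0 := fun s hs =>
    qFacInv_of_neg q (by omega)
  have hg : Summable g := by
    refine summable_of_hasFiniteSupport
      (((Set.finite_Iic n).prod (finite_tailSum_le n)).subset ?_)
    rintro ⟨s, ν⟩ h
    have h1 : s ≤ n := by
      by_contra hlt
      exact h (by simp [g, hn s (not_le.mp hlt)])
    refine ⟨h1, ?_⟩
    by_contra hlt
    refine h ?_
    simp only [g]
    rw [multisumTerm_eq_zero q (lt_of_le_of_lt h1 (not_le.mp (show ¬ tailSum ν 0 ≤ n from hlt))), mul_zero]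
  have e1 : ∑' ν, multisumTerm (m + 1 + 1) q n ν = ∑' p, g (φ p) := by
    change ∑' ν : Fin (m + 1) → ℕ, multisumTerm (m + 1 + 1) q n ν = _
    rw [← (Fin.consEquiv fun _ : Fin (m + 1) => ℕ).tsum_eq]
    exact tsum_congr fun p => multisumTerm_cons m q n p.1 p.2
  rw [e1, hφ.tsum_eq (fun p hp => by by_contra h; exact hp (hsupp p h)), hg.tsum_prod,
    tsum_eq_sum (s := range (n + 1))]
  · refine sum_congr rfl fun s _ => ?_
    simp only [g]
    rw [tsum_mul_left]; rfl
  · intro s hs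
    simp [g, hn s (by simpa [Nat.lt_succ_iff] using hs)]

theorem tsum_multisumTerm {q : ℂ} (hq : ‖q‖ < 1) (hq0 : q ≠ 0) (m n : ℕ) :
    ∑' ν, multisumTerm (m + 1) q n ν = baileyBeta (m + 1) q n := by
  induction m generalizing n with
  | zero =>
    rw [baileyBeta_succ hq hq0, sum_eq_single_of_mem 0 (by simp)
      fun s _ hs => by rw [baileyBeta_zero hq hq0, if_neg hs, mul_zero]]
    rw [baileyBeta_zero hq hq0]
    change ∑' ν : Fin 0 → ℕ, multisumTerm 1 q n ν = _
    rw [tsum_fintype]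
    simp [multisumTerm, tailSum]
  | succ m ih =>
    rw [tsum_multisumTerm_succ, baileyBeta_succ hq hq0]
    exact sum_congr rfl fun s _ => by rw [ih]

/-! ### The conjugate Bailey sequence and its recurrence. -/

/-- The sequence `(q;q)_{2n} / ((a;q)_{n+1} (q/a;q)_n)`. -/
noncomputable def deltaSeq (a q : ℂ) (n : ℕ) : ℂ :=
  qPoch q q (2 * n) / (qPoch a q (n + 1) * qPoch (q / a) q n)

theorem mul_pow_ne_one_of_ne_zpow {q a : ℂ} (haq : ∀ m : ℤ, a ≠ q ^ m) (j : ℕ) :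
    a * q ^ j ≠ 1 := fun h => haq (-j) (by
  rw [zpow_neg, zpow_natCast]; exact eq_inv_of_mul_eq_one_left h)

theorem div_mul_pow_ne_one_of_ne_zpow {q a : ℂ} (ha : a ≠ 0) (haq : ∀ m : ℤ, a ≠ q ^ m) (j : ℕ) :
    q / a * q ^ j ≠ 1 := fun h => haq (j + 1 : ℕ) (by
  rw [zpow_natCast, pow_succ]; field_simp at h; linear_combination -h)

theorem deltaSeq_succ {q a : ℂ} (ha : a ≠ 0) (haq : ∀ m : ℤ, a ≠ q ^ m) (n : ℕ) :
    (1 - a * q ^ (n + 1)) * (1 - q ^ (n + 1) / a) * deltaSeq a q (n + 1)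
      = (1 - q ^ (2 * n + 1)) * (1 - q ^ (2 * n + 2)) * deltaSeq a q n := by
  have h1 := qPoch_ne_zero (mul_pow_ne_one_of_ne_zpow haq) (n + 1 + 1)
  have h2 := qPoch_ne_zero (div_mul_pow_ne_one_of_ne_zpow ha haq) (n + 1)
  rw [deltaSeq, deltaSeq, show 2 * (n + 1) = 2 * n + 1 + 1 by ring, qPoch_succ q q (2 * n + 1),
    qPoch_succ q q (2 * n)]
  rw [qPoch_succ a q (n + 1), qPoch_succ (q / a) q n]
  rw [qPoch_succ] at h1 h2
  have h3 := left_ne_zero_of_mul h1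
  have h4 := right_ne_zero_of_mul h1
  have h5 := left_ne_zero_of_mul h2
  have h6 := right_ne_zero_of_mul h2
  have e : q / a * q ^ n = q ^ (n + 1) / a := by rw [pow_succ]; ring
  rw [e] at h6 ⊢
  generalize 1 - q ^ (n + 1) / a = z at *
  field_simp
  ring

theorem tendsto_deltaSeq {q a : ℂ} (hq : ‖q‖ < 1) (ha : a ≠ 0) (haq : ∀ m : ℤ, a ≠ q ^ m) :
    Tendsto (deltaSeq a q) atTop (𝓝 (qPochInf q q / (qPochInf a q * qPochInf (q / a) q))) := by
  refine Tendsto.div ?_ (Tendsto.mul ?_ (tendsto_qPoch hq _)) (mul_ne_zero ?_ ?_)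
  · exact (tendsto_qPoch hq q).comp (tendsto_id.const_mul_atTop' two_pos)
  · exact (tendsto_qPoch hq a).comp (tendsto_add_atTop_nat 1)
  · exact qPochInf_ne_zero hq (mul_pow_ne_one_of_ne_zpow haq)
  · exact qPochInf_ne_zero hq (div_mul_pow_ne_one_of_ne_zpow ha haq)

/-- The summand of the conjugate Bailey sequence. -/
noncomputable def gammaTerm (a q : ℂ) (r n : ℕ) : ℂ :=
  q ^ n * deltaSeq a q n * qFacInv q ((n : ℤ) - r) * qFacInv q (n + r + 1 : ℤ)

/-- The conjugate Bailey sequence `γ_r = ∑_n q^n δ_n / ((q)_{n-r} (q)_{n+r+1})`. -/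
noncomputable def gammaSeq (a q : ℂ) (r : ℕ) : ℂ := ∑' n, gammaTerm a q r n

theorem exists_norm_gammaTerm_le {q a : ℂ} (hq : ‖q‖ < 1) (ha : a ≠ 0)
    (haq : ∀ m : ℤ, a ≠ q ^ m) :
    ∃ C, 0 < C ∧ ∀ r n, ‖gammaTerm a q r n‖ ≤ C * ‖q‖ ^ n := by
  obtain ⟨C, hC0, hC⟩ := exists_norm_le_of_tendsto (tendsto_deltaSeq hq ha haq)
  obtain ⟨D, hD0, hD⟩ := exists_norm_qFacInv_le hq
  refine ⟨C * D * D, by positivity, fun r n => ?_⟩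
  rw [gammaTerm, norm_mul, norm_mul, norm_mul, norm_pow,
    show C * D * D * ‖q‖ ^ n = ‖q‖ ^ n * C * D * D by ring]
  gcongr
  exacts [hC _, hD _, hD _]

theorem summable_gammaTerm {q a : ℂ} (hq : ‖q‖ < 1) (ha : a ≠ 0)
    (haq : ∀ m : ℤ, a ≠ q ^ m) (r : ℕ) : Summable (gammaTerm a q r) := by
  obtain ⟨C, _, hC⟩ := exists_norm_gammaTerm_le hq ha haq
  exact Summable.of_norm_bounded ((summable_geometric_of_lt_one (norm_nonneg q) hq).mul_left C)
    (hC r)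

theorem exists_norm_gammaSeq_le {q a : ℂ} (hq : ‖q‖ < 1) (ha : a ≠ 0)
    (haq : ∀ m : ℤ, a ≠ q ^ m) : ∃ C, ∀ r, ‖gammaSeq a q r‖ ≤ C := by
  obtain ⟨C, _, hC⟩ := exists_norm_gammaTerm_le hq ha haq
  exact ⟨_, fun r => tsum_of_norm_bounded
    ((summable_geometric_of_lt_one (norm_nonneg q) hq).mul_left C).hasSum (hC r)⟩

/-- Creative telescoping: the same combination of summands is a forward difference `T (n+1) - T n`.
Since `T 0 = 0`, the right side is the limit of `T`. -/
theorem gammaSeq_recurrence {q a : ℂ} (hq : ‖q‖ < 1) (hq0 : q ≠ 0) (ha : a ≠ 0)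
    (haq : ∀ m : ℤ, a ≠ q ^ m) (r : ℕ) :
    (1 - q ^ (2 * r + 1)) * gammaSeq a q r
      + (a + 1 / a) * q ^ r * ((1 - q ^ (2 * (r + 1) + 1)) * gammaSeq a q (r + 1))
      + q ^ (2 * r + 1) * ((1 - q ^ (2 * (r + 2) + 1)) * gammaSeq a q (r + 2))
      = (q ^ r - q ^ (3 * r + 3)) / qPochInf₃ q a (q / a) q := by
  -- The factor `(1 - a q^n)(1 - q^n/a)` is chosen so that `deltaSeq_succ` rewrites `T (n+1)` in
  -- terms of `δ_n`.
  let T : ℕ → ℂ := fun n => q ^ r * (1 - q ^ (2 * r + 3)) * qFacInv q ((n : ℤ) - r - 1)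
    * qFacInv q (n + r + 2 : ℤ) * ((1 - a * q ^ n) * (1 - q ^ n / a) * deltaSeq a q n)
  have key : ∀ n, (1 - q ^ (2 * r + 1)) * gammaTerm a q r n
      + (a + 1 / a) * q ^ r * ((1 - q ^ (2 * (r + 1) + 1)) * gammaTerm a q (r + 1) n)
      + q ^ (2 * r + 1) * ((1 - q ^ (2 * (r + 2) + 1)) * gammaTerm a q (r + 2) n)
      = T (n + 1) - T n := by
    intro n
    simp only [gammaTerm, T]
    rw [deltaSeq_succ ha haq]
    have e1 : (n : ℤ) - (r + 1 : ℕ) = n - r - 1 := by push_cast; ring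
    have e2 : (n : ℤ) - (r + 2 : ℕ) = n - r - 1 - 1 := by push_cast; ring
    have e3 : ((n + 1 : ℕ) : ℤ) - r - 1 = n - r := by push_cast; ring
    have e4 : (n : ℤ) + (r + 2 : ℕ) + 1 = n + r + 3 := by push_cast; ring
    have e5 : (n : ℤ) + (r + 1 : ℕ) + 1 = n + r + 3 - 1 := by push_cast; ring
    have e6 : (n : ℤ) + r + 1 = n + r + 3 - 1 - 1 := by ring
    have e7 : (n : ℤ) + r + 2 = n + r + 3 - 1 := by ring
    have e8 : ((n + 1 : ℕ) : ℤ) + r + 2 = n + r + 3 := by push_cast; ring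
    rw [e1, e2, e3, e4, e5, e6, e7, e8]
    -- All reciprocal factorials become multiples of `1/(q;q)_{n-r}` and `1/(q;q)_{n+r+3}`, which
    -- leaves a rational identity in `q^n`, `q^r`, `q` and `a`.
    rw [qFacInv_sub_one hq ((n : ℤ) - r - 1), qFacInv_sub_one hq ((n : ℤ) - r),
      qFacInv_sub_one hq ((n : ℤ) + r + 3 - 1), qFacInv_sub_one hq ((n : ℤ) + r + 3)]
    have f1 : q ^ ((n : ℤ) - r) = q ^ n / q ^ r := by
      rw [zpow_sub₀ hq0, zpow_natCast, zpow_natCast]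
    have f2 : q ^ ((n : ℤ) - r - 1) = q ^ n / q ^ r / q := by
      rw [zpow_sub₀ hq0, f1, zpow_one]
    have f3 : q ^ ((n : ℤ) + r + 3) = q ^ n * q ^ r * q ^ 3 := by
      rw [← pow_add, ← pow_add, ← zpow_natCast]; rfl
    have f4 : q ^ ((n : ℤ) + r + 3 - 1) = q ^ n * q ^ r * q ^ 2 := by
      rw [← pow_add, ← pow_add, ← zpow_natCast]; congr 1; push_cast; ring
    rw [f1, f2, f3, f4]
    have hr := pow_ne_zero r hq0
    generalize deltaSeq a q n = d
    generalize qFacInv q ((n : ℤ) - r) = A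
    generalize qFacInv q ((n : ℤ) + r + 3) = B
    have g1 : q ^ (2 * r + 1) = (q ^ r) ^ 2 * q := by ring
    have g2 : q ^ (2 * (r + 1) + 1) = (q ^ r) ^ 2 * q ^ 3 := by ring
    have g3 : q ^ (2 * (r + 2) + 1) = (q ^ r) ^ 2 * q ^ 5 := by ring
    have g4 : q ^ (2 * r + 3) = (q ^ r) ^ 2 * q ^ 3 := by ring
    have g5 : q ^ (2 * n + 1) = (q ^ n) ^ 2 * q := by ring
    have g6 : q ^ (2 * n + 2) = (q ^ n) ^ 2 * q ^ 2 := by ring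
    rw [g1, g2, g3, g4, g5, g6]
    generalize q ^ r = y at *
    generalize q ^ n = x at *
    field_simp
    ring
  have hs := fun s => summable_gammaTerm hq ha haq s
  have hsum : HasSum (fun n => T (n + 1) - T n)
      ((1 - q ^ (2 * r + 1)) * gammaSeq a q r
      + (a + 1 / a) * q ^ r * ((1 - q ^ (2 * (r + 1) + 1)) * gammaSeq a q (r + 1))
      + q ^ (2 * r + 1) * ((1 - q ^ (2 * (r + 2) + 1)) * gammaSeq a q (r + 2))) := by
    simp only [← key]
    exact (((hs r).hasSum.mul_left _).add (((hs (r + 1)).hasSum.mul_left _).mul_left _)).add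
      (((hs (r + 2)).hasSum.mul_left _).mul_left _)
  have h1 := hsum.tendsto_sum_nat
  have hT0 : T 0 = 0 := by
    simp only [T]
    rw [qFacInv_of_neg q (show ((0 : ℕ) : ℤ) - r - 1 < 0 by push_cast; omega)]; simp
  simp only [sum_range_sub, hT0, sub_zero] at h1
  refine tendsto_nhds_unique h1 ?_
  have hp : Tendsto (fun n : ℕ => q ^ n) atTop (𝓝 0) := tendsto_pow_atTop_nhds_zero_of_norm_lt_one hq
  have t1 := tendsto_qFacInv_natCast_add hq (-r - 1)
  have t2 := tendsto_qFacInv_natCast_add hq (r + 2)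
  have t3 := ((tendsto_const_nhds (x := (1 : ℂ))).sub (hp.const_mul a)).mul
    ((tendsto_const_nhds (x := (1 : ℂ))).sub (hp.div_const a))
  have t := ((t1.const_mul (q ^ r * (1 - q ^ (2 * r + 3)))).mul t2).mul
    (t3.mul (tendsto_deltaSeq hq ha haq))
  have n1 := qPochInf_self_ne_zero hq
  have n2 := qPochInf_ne_zero hq (mul_pow_ne_one_of_ne_zpow haq)
  have n3 := qPochInf_ne_zero hq (div_mul_pow_ne_one_of_ne_zpow ha haq)
  convert t using 2 with n
  · simp only [T]
    rw [show (n : ℤ) + (-r - 1) = n - r - 1 by ring, show (n : ℤ) + (r + 2) = n + r + 2 by ring]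
  · rw [qPochInf₃]
    field_simp
    ring

/-! ### Theta series and the Jacobi triple product. -/

/-- The triangular numbers `t (t - 1) / 2`, `t ∈ ℤ`. -/
def triInt (t : ℤ) : ℤ := t * (t - 1) / 2

theorem two_mul_triInt (t : ℤ) : 2 * triInt t = t * (t - 1) :=
  Int.mul_ediv_cancel' (by simpa [mul_comm] using (Int.even_mul_pred_self t).two_dvd)

theorem triInt_natCast (n : ℕ) : triInt n = n.choose 2 := by
  have h : 2 * ((n.choose 2 : ℕ) : ℤ) = n * (n - 1) := by
    induction n with
    | zero => simp
    | succ n ih => rw [Nat.choose_succ_succ' n 1, Nat.choose_one_right]; push_cast; linarith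
  have := two_mul_triInt n
  omega

/-- The summand `b^t p^{t(t-1)/2}` of the theta series. -/
noncomputable def thetaTerm (b p : ℂ) (t : ℤ) : ℂ := b ^ t * p ^ triInt t

theorem thetaTerm_natCast (b p : ℂ) (n : ℕ) : thetaTerm b p n = b ^ n * p ^ n.choose 2 := by
  rw [thetaTerm, triInt_natCast, zpow_natCast, zpow_natCast]

theorem thetaTerm_ne_zero {b p : ℂ} (hb : b ≠ 0) (hp : p ≠ 0) (t : ℤ) : thetaTerm b p t ≠ 0 :=
  mul_ne_zero (zpow_ne_zero _ hb) (zpow_ne_zero _ hp)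

theorem thetaTerm_add {b p : ℂ} (hb : b ≠ 0) (hp : p ≠ 0) (s t : ℤ) :
    thetaTerm b p (s + t) = thetaTerm b p s * thetaTerm (b * p ^ s) p t := by
  have e : triInt (s + t) = triInt s + (s * t + triInt t) := by
    have h1 := two_mul_triInt (s + t)
    have h2 := two_mul_triInt s
    have h3 := two_mul_triInt t
    have : 2 * triInt (s + t) = 2 * (triInt s + (s * t + triInt t)) := by
      linear_combination h1 - h2 - h3
    omega
  rw [thetaTerm, thetaTerm, thetaTerm, e, zpow_add₀ hb, zpow_add₀ hp, zpow_add₀ hp, mul_zpow,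
    ← zpow_mul]
  ring

theorem thetaTerm_neg_sub_one {b p : ℂ} (hb : b ≠ 0) (hp : p ≠ 0) (t : ℤ) :
    thetaTerm b p (-(t + 1)) = p / b * thetaTerm (p ^ 2 / b) p t := by
  have e : triInt (-(t + 1)) = triInt t + 2 * t + 1 := by
    have h1 := two_mul_triInt (-(t + 1))
    have h2 := two_mul_triInt t
    have : 2 * triInt (-(t + 1)) = 2 * (triInt t + 2 * t + 1) := by
      linear_combination h1 - h2
    omega
  rw [thetaTerm, thetaTerm, e, zpow_neg, zpow_add₀ hb, zpow_add₀ hp, zpow_add₀ hp, div_zpow,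
    zpow_mul]
  simp only [zpow_ofNat]
  field_simp

theorem summable_pow_mul_pow_choose {p : ℂ} (hp : ‖p‖ < 1) (b : ℂ) :
    Summable fun n : ℕ => ‖b ^ n * p ^ n.choose 2‖ := by
  rcases eq_or_ne b 0 with rfl | hb
  · exact summable_of_ne_finset_zero (s := {0}) fun n hn => by simp [zero_pow (by simpa using hn)]
  rcases eq_or_ne p 0 with rfl | hp0
  · refine summable_of_ne_finset_zero (s := range 2) fun n hn => ?_
    have : n.choose 2 ≠ 0 := (Nat.choose_pos (not_lt.mp (by simpa using hn))).ne'
    simp [zero_pow this]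
  refine summable_of_ratio_test_tendsto_lt_one (l := 0) one_pos
    (Eventually.of_forall fun n => norm_ne_zero_iff.mpr
      (mul_ne_zero (pow_ne_zero _ hb) (pow_ne_zero _ hp0))) ?_
  have h : Tendsto (fun n : ℕ => ‖b‖ * ‖p‖ ^ n) atTop (𝓝 (‖b‖ * 0)) :=
    (tendsto_pow_atTop_nhds_zero_of_lt_one (norm_nonneg p) hp).const_mul _
  rw [mul_zero] at h
  refine h.congr fun n => ?_
  have h1 := norm_ne_zero_iff.mpr hb
  have h2 := norm_ne_zero_iff.mpr hp0
  rw [Nat.choose_succ_succ' n 1, Nat.choose_one_right]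
  simp only [norm_mul, norm_pow, norm_norm, pow_add, pow_one]
  field_simp

theorem summable_norm_thetaTerm {b p : ℂ} (hp : ‖p‖ < 1) (hb : b ≠ 0) (hp0 : p ≠ 0) :
    Summable fun t : ℤ => ‖thetaTerm b p t‖ := by
  refine Summable.of_nat_of_neg_add_one ?_ ?_
  · simpa only [thetaTerm_natCast] using summable_pow_mul_pow_choose hp b
  · simp only [thetaTerm_neg_sub_one hb hp0, thetaTerm_natCast, norm_mul _ (_ * _)]
    exact (summable_pow_mul_pow_choose hp _).mul_left _

/-- Rothe's finite form of the `q`-binomial theorem. -/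
theorem sum_rothe {q : ℂ} (hq : ‖q‖ < 1) (N : ℕ) (z : ℂ) :
    qPoch q q N * ∑ m ∈ range (N + 1), (-z) ^ m * q ^ m.choose 2 * qFacInv q m
      * qFacInv q ((N : ℤ) - m) = qPoch z q N := by
  induction N generalizing z with
  | zero => simp [qPoch_zero, qFacInv_zero]
  | succ N ih =>
    -- Here `1 - q^{N+1} = q^m (1 - q^{N+1-m}) + (1 - q^m)`; the factor `q^m` turns `z` into `zq`,
    -- so both pieces reduce to the induction hypothesis at `zq`.
    have key : ∀ m ∈ range (N + 1 + 1), (1 - q ^ (N + 1)) * ((-z) ^ m * q ^ m.choose 2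
        * qFacInv q m * qFacInv q (((N + 1 : ℕ) : ℤ) - m))
        = (-(z * q)) ^ m * q ^ m.choose 2 * qFacInv q m * qFacInv q ((N : ℤ) - m)
        + (-z) ^ m * q ^ m.choose 2 * qFacInv q ((m : ℤ) - 1)
          * qFacInv q (((N + 1 : ℕ) : ℤ) - m) := by
      intro m hm
      have hm' : m ≤ N + 1 := by simpa [Nat.lt_succ_iff] using hm
      have e1 : (N : ℤ) - m = ((N + 1 : ℕ) - m) - 1 := by push_cast; ring
      have e2 : ((N + 1 : ℕ) : ℤ) - m = (N + 1 - m : ℕ) := by omega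
      have e3 : q ^ (N + 1) = q ^ m * q ^ (N + 1 - m) := by
        rw [← pow_add, Nat.add_sub_cancel' hm']
      rw [e1, qFacInv_sub_one hq, qFacInv_sub_one hq, e2, zpow_natCast, zpow_natCast, e3,
        show -(z * q) = -z * q by ring, mul_pow]
      ring
    have hp : qPoch z q (N + 1) = (1 - z) * qPoch (z * q) q N := by
      rw [qPoch, prod_range_succ', mul_comm, qPoch]
      simp [pow_succ', mul_assoc]
    rw [qPoch_succ, hp, ← ih (z * q), mul_assoc, ← pow_succ', mul_sum, sum_congr rfl key,
      sum_add_distrib, sum_range_succ, sum_range_succ' (fun m => (-z) ^ m * q ^ m.choose 2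
        * qFacInv q ((m : ℤ) - 1) * qFacInv q (((N + 1 : ℕ) : ℤ) - m))]
    have z1 : qFacInv q ((N : ℤ) - (N + 1 : ℕ)) = 0 := qFacInv_of_neg q (by push_cast; omega)
    have z2 : qFacInv q (((0 : ℕ) : ℤ) - 1) = 0 := qFacInv_of_neg q (by simp)
    have s2 : ∑ m ∈ range (N + 1), (-z) ^ (m + 1) * q ^ (m + 1).choose 2
        * qFacInv q (((m + 1 : ℕ) : ℤ) - 1) * qFacInv q (((N + 1 : ℕ) : ℤ) - (m + 1 : ℕ))
        = -z * ∑ m ∈ range (N + 1), (-(z * q)) ^ m * q ^ m.choose 2 * qFacInv q m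
          * qFacInv q ((N : ℤ) - m) := by
      rw [mul_sum]
      refine sum_congr rfl fun m _ => ?_
      have e1 : ((m + 1 : ℕ) : ℤ) - 1 = m := by push_cast; ring
      have e2 : ((N + 1 : ℕ) : ℤ) - (m + 1 : ℕ) = N - m := by push_cast; ring
      rw [e1, e2, Nat.choose_succ_succ' m 1, Nat.choose_one_right, show -(z * q) = -z * q by ring,
        mul_pow]
      ring
    rw [z1, z2, s2]
    ring

/-- The factors are `1 - a q^{-j} = -a q^{-j} (1 - q^j/a)` for `1 ≤ j ≤ n`; the extracted monomials
multiply to the inverse theta term. -/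
theorem qPoch_mul_zpow_neg {q a : ℂ} (hq0 : q ≠ 0) (ha : a ≠ 0) (n : ℕ) :
    qPoch (a * q ^ (-n : ℤ)) q n = (thetaTerm (-a) q (-n))⁻¹ * qPoch (q / a) q n := by
  induction n with
  | zero => simp [qPoch_zero, thetaTerm, triInt]
  | succ n ih =>
    have e1 : thetaTerm (-a) q (-(n + 1 : ℕ)) = thetaTerm (-a) q (-n) * (-a * q ^ (-n : ℤ))⁻¹ * q := by
      rw [show (-((n + 1 : ℕ) : ℤ)) = -n + -1 by push_cast; ring,
        thetaTerm_add (neg_ne_zero.mpr ha) hq0, mul_assoc]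
      simp [thetaTerm, triInt]
    have e2 : ∀ j ∈ range n, 1 - a * q ^ (-((n + 1 : ℕ) : ℤ)) * q ^ (j + 1)
        = 1 - a * q ^ (-n : ℤ) * q ^ j := by
      intro j _
      rw [zpow_neg, zpow_neg, zpow_natCast, zpow_natCast, pow_succ, pow_succ]
      have := pow_ne_zero n hq0
      field_simp
    rw [qPoch, prod_range_succ', prod_congr rfl e2, qPoch_succ, e1]
    rw [qPoch] at ih
    rw [ih, zpow_neg, zpow_neg, zpow_natCast, zpow_natCast, pow_succ]
    have := pow_ne_zero n hq0
    have := thetaTerm_ne_zero (neg_ne_zero.mpr ha) hq0 (-n)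
    field_simp
    ring

/-- A finite form of the Jacobi triple product identity. -/
theorem sum_thetaTerm_finite {q a : ℂ} (hq : ‖q‖ < 1) (hq0 : q ≠ 0) (ha : a ≠ 0) (n : ℕ) :
    ∑ t ∈ Icc (-n : ℤ) n, thetaTerm (-a) q t * (qPoch q q (2 * n) * qFacInv q (n + t)
      * qFacInv q (n - t)) = qPoch a q n * qPoch (q / a) q n := by
  have hna : -a ≠ 0 := neg_ne_zero.mpr ha
  have h0 := thetaTerm_ne_zero hna hq0 (-n)
  have split : ∀ n : ℕ, qPoch (a * q ^ (-n : ℤ)) q (2 * n)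
      = (thetaTerm (-a) q (-n))⁻¹ * (qPoch a q n * qPoch (q / a) q n) := by
    intro n
    have h1 : ∀ N, qPoch (a * q ^ (-n : ℤ)) q (n + N)
        = qPoch (a * q ^ (-n : ℤ)) q n * qPoch a q N := by
      intro N
      rw [qPoch, prod_range_add, qPoch, qPoch]
      congr 1
      refine prod_congr rfl fun j _ => ?_
      rw [pow_add, zpow_neg, zpow_natCast]
      have := pow_ne_zero n hq0
      field_simp
    rw [two_mul, h1, qPoch_mul_zpow_neg hq0 ha]; ring
  -- Rothe's formula of length `2n` at `z = a q^{-n}` has its product centred at `a`; the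
  -- substitution `t = m - n` makes the sum symmetric.
  have r := sum_rothe hq (2 * n) (a * q ^ (-n : ℤ))
  rw [split] at r
  rw [eq_inv_mul_iff_mul_eq₀ h0] at r
  rw [← r, ← mul_assoc, mul_sum]
  symm
  refine sum_bij (fun m _ => (m : ℤ) - n) ?_ ?_ ?_ ?_
  · intro m hm
    simp at hm ⊢; omega
  · intro m _ m' _ h
    simpa using h
  · intro t ht
    simp at ht
    exact ⟨(t + n).toNat, by simp; omega, by simp; omega⟩
  · intro m _
    have e := thetaTerm_add hna hq0 (-n) m
    rw [show (m : ℤ) - n = -n + m by ring, e, thetaTerm_natCast]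
    have e1 : (n : ℤ) + (-n + m) = m := by ring
    have e2 : (n : ℤ) - (-n + m) = (2 * n : ℕ) - m := by push_cast; ring
    rw [e1, e2, neg_mul]
    ring

/-- Let `n → ∞` in `sum_thetaTerm_finite`. The `q`-binomial weights are uniformly bounded and tend
to `1/(q;q)_∞`, so dominated convergence applies with the theta series as majorant. -/
theorem qPochInf₃_eq_tsum {q a : ℂ} (hq : ‖q‖ < 1) (hq0 : q ≠ 0) (ha : a ≠ 0) :
    qPochInf₃ q a (q / a) q = ∑' t : ℤ, thetaTerm (-a) q t := by
  have hna : -a ≠ 0 := neg_ne_zero.mpr ha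
  obtain ⟨C, hC0, hC⟩ := exists_norm_le_of_tendsto (tendsto_qPoch hq q)
  obtain ⟨D, hD0, hD⟩ := exists_norm_qFacInv_le hq
  have h1 : Tendsto (fun n : ℕ => ∑' t : ℤ, thetaTerm (-a) q t * (qPoch q q (2 * n)
      * qFacInv q (n + t) * qFacInv q (n - t))) atTop
      (𝓝 (∑' t : ℤ, thetaTerm (-a) q t * (qPochInf q q * (1 / qPochInf q q)
        * (1 / qPochInf q q)))) := by
    refine tendsto_tsum_of_dominated_convergence
      (bound := fun t => ‖thetaTerm (-a) q t‖ * (C * D * D))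
      ((summable_norm_thetaTerm hq hna hq0).mul_right _) ?_ ?_
    · intro t
      refine Tendsto.const_mul _ (Tendsto.mul (Tendsto.mul ?_ ?_) ?_)
      · exact (tendsto_qPoch hq q).comp (tendsto_id.const_mul_atTop' two_pos)
      · exact tendsto_qFacInv_natCast_add hq t
      · simpa only [sub_eq_add_neg] using tendsto_qFacInv_natCast_add hq (-t)
    · refine Eventually.of_forall fun n t => ?_
      rw [norm_mul, norm_mul, norm_mul]
      gcongr
      exacts [hC _, hD _, hD _]
  have h2 : ∀ n : ℕ, ∑' t : ℤ, thetaTerm (-a) q t * (qPoch q q (2 * n)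
      * qFacInv q (n + t) * qFacInv q (n - t)) = qPoch a q n * qPoch (q / a) q n := by
    intro n
    rw [← sum_thetaTerm_finite hq hq0 ha n]
    refine tsum_eq_sum fun t ht => ?_
    rw [mem_Icc, not_and_or] at ht
    rcases ht with ht | ht
    · rw [qFacInv_of_neg q (show (n : ℤ) + t < 0 by omega)]; ring
    · rw [qFacInv_of_neg q (show (n : ℤ) - t < 0 by omega)]; ring
  simp only [h2] at h1
  have h3 := tendsto_nhds_unique ((tendsto_qPoch hq a).mul (tendsto_qPoch hq (q / a))) h1
  rw [tsum_mul_right] at h3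
  have := qPochInf_self_ne_zero hq
  rw [qPochInf₃, mul_assoc, h3]
  field_simp

/-! ### Solving the recurrence by partial theta functions. -/

/-- For large `r` the coefficients of `D (r+1)` and `D (r+2)` have total size at most `1/2`, so any
bound valid from there on can be halved indefinitely. Hence `D` vanishes eventually, and the
recurrence carries the zeros down to `r = 0`. -/
theorem eq_zero_of_recurrence {q c : ℂ} (hq : ‖q‖ < 1) {D : ℕ → ℂ} {C : ℝ} (hC : ∀ r, ‖D r‖ ≤ C)
    (h : ∀ r, D r + c * q ^ r * D (r + 1) + q ^ (2 * r + 1) * D (r + 2) = 0) (r : ℕ) : D r = 0 := by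
  have hp : Tendsto (fun r : ℕ => ‖q‖ ^ r) atTop (𝓝 0) :=
    tendsto_pow_atTop_nhds_zero_of_lt_one (norm_nonneg q) hq
  have ht : Tendsto (fun r : ℕ => ‖c‖ * ‖q‖ ^ r + ‖q‖ ^ (2 * r + 1)) atTop (𝓝 (‖c‖ * 0 + 0)) :=
    (hp.const_mul _).add (hp.comp (tendsto_atTop_mono (fun r => show id r ≤ 2 * r + 1 by simp only [id]; omega) tendsto_id))
  rw [mul_zero, add_zero] at ht
  obtain ⟨R, hR⟩ := eventually_atTop.mp (ht.eventually_le_const (show (0 : ℝ) < 1 / 2 by norm_num))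
  have hbound : ∀ m : ℕ, ∀ r, R ≤ r → ‖D r‖ ≤ C * (1 / 2) ^ m := by
    intro m
    induction m with
    | zero => intro r _; simpa using hC r
    | succ m ih =>
      intro r hr
      have e : D r = -(c * q ^ r * D (r + 1) + q ^ (2 * r + 1) * D (r + 2)) := by
        linear_combination h r
      have h0 : 0 ≤ C * (1 / 2) ^ m := (norm_nonneg _).trans (ih r hr)
      calc ‖D r‖ ≤ ‖c‖ * ‖q‖ ^ r * ‖D (r + 1)‖ + ‖q‖ ^ (2 * r + 1) * ‖D (r + 2)‖ := by
            rw [e, norm_neg]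
            refine (norm_add_le _ _).trans (le_of_eq ?_)
            simp only [norm_mul, norm_pow]
        _ ≤ ‖c‖ * ‖q‖ ^ r * (C * (1 / 2) ^ m) + ‖q‖ ^ (2 * r + 1) * (C * (1 / 2) ^ m) := by
            gcongr
            exacts [ih _ (by omega), ih _ (by omega)]
        _ = (‖c‖ * ‖q‖ ^ r + ‖q‖ ^ (2 * r + 1)) * (C * (1 / 2) ^ m) := by ring
        _ ≤ 1 / 2 * (C * (1 / 2) ^ m) := by gcongr; exact hR r hr
        _ = C * (1 / 2) ^ (m + 1) := by ring
  have hlarge : ∀ r, R ≤ r → D r = 0 := by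
    intro r hr
    have hl : Tendsto (fun m : ℕ => C * (1 / 2 : ℝ) ^ m) atTop (𝓝 (C * 0)) :=
      (tendsto_pow_atTop_nhds_zero_of_lt_one (by norm_num) (by norm_num)).const_mul _
    rw [mul_zero] at hl
    exact norm_le_zero_iff.mp (ge_of_tendsto' hl fun m => hbound m r hr)
  have hall : ∀ d r, R ≤ r + d → D r = 0 := by
    intro d
    induction d with
    | zero => exact hlarge
    | succ d ih =>
      intro r hr
      have := h r
      rw [ih (r + 1) (by omega), ih (r + 2) (by omega)] at this
      simpa using this
  exact hall R r (by omega)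

/-- The partial theta function `∑_{j ≥ 0} b^j q^{j(j-1)/2}`. -/
noncomputable def partialTheta (q b : ℂ) : ℂ := ∑' j : ℕ, b ^ j * q ^ j.choose 2

theorem partialTheta_eq {q : ℂ} (hq : ‖q‖ < 1) (b : ℂ) :
    partialTheta q b = 1 + b * partialTheta q (b * q) := by
  rw [partialTheta, (summable_pow_mul_pow_choose hq b).of_norm.tsum_eq_zero_add, partialTheta,
    ← tsum_mul_left]
  congr 1
  · simp
  · refine tsum_congr fun j => ?_
    rw [Nat.choose_succ_succ' j 1, Nat.choose_one_right]; ring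

theorem norm_partialTheta_le {q : ℂ} (hq : ‖q‖ < 1) {b c : ℂ} (hbc : ‖b‖ ≤ ‖c‖) :
    ‖partialTheta q b‖ ≤ ∑' j : ℕ, ‖c ^ j * q ^ j.choose 2‖ :=
  tsum_of_norm_bounded (summable_pow_mul_pow_choose hq c).hasSum fun j => by
    simp only [norm_mul, norm_pow]; gcongr

/-- The difference of partial theta functions which evaluates the conjugate Bailey sequence. -/
noncomputable def partialThetaDiff (a q : ℂ) (r : ℕ) : ℂ :=
  q ^ r * partialTheta q (-(a * q ^ (r + 1)))
    - q ^ (2 * r + 1) / a * partialTheta q (-(q ^ (r + 2) / a))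

theorem exists_norm_partialThetaDiff_le {q : ℂ} (hq : ‖q‖ < 1) (a : ℂ) :
    ∃ C, ∀ r, ‖partialThetaDiff a q r‖ ≤ C := by
  refine ⟨1 * (∑' j : ℕ, ‖a ^ j * q ^ j.choose 2‖)
    + 1 / ‖a‖ * (∑' j : ℕ, ‖(1 / a) ^ j * q ^ j.choose 2‖), fun r => ?_⟩
  have h1 : ∀ n, ‖q‖ ^ n ≤ 1 := fun n => pow_le_one₀ (norm_nonneg q) hq.le
  refine (norm_sub_le _ _).trans ?_
  rw [norm_mul, norm_mul, norm_div, norm_pow, norm_pow]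
  gcongr
  · exact h1 _
  · refine norm_partialTheta_le hq ?_
    rw [norm_neg, norm_mul, norm_pow]
    exact mul_le_of_le_one_right (norm_nonneg _) (h1 _)
  · exact h1 _
  · refine norm_partialTheta_le hq ?_
    rw [norm_neg, norm_div, norm_div, norm_pow, norm_one]
    gcongr
    exact h1 _

/-- The functional equation `partialTheta_eq` reduces every term to one partial theta in `a` and one
in `1/a`; their coefficients cancel and only the inhomogeneous term remains. -/
theorem partialThetaDiff_recurrence {q a : ℂ} (hq : ‖q‖ < 1) (ha : a ≠ 0) (r : ℕ) :
    partialThetaDiff a q r + (a + 1 / a) * q ^ r * partialThetaDiff a q (r + 1)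
      + q ^ (2 * r + 1) * partialThetaDiff a q (r + 2) = q ^ r - q ^ (3 * r + 3) := by
  have p : ∀ s, partialTheta q (-(a * q ^ (s + 1)))
      = 1 - a * q ^ (s + 1) * partialTheta q (-(a * q ^ (s + 1 + 1))) := fun s => by
    rw [partialTheta_eq hq, show -(a * q ^ (s + 1)) * q = -(a * q ^ (s + 1 + 1)) by ring]; ring
  have p' : ∀ s, partialTheta q (-(q ^ (s + 2) / a))
      = 1 - q ^ (s + 2) / a * partialTheta q (-(q ^ (s + 1 + 2) / a)) := fun s => by
    rw [partialTheta_eq hq, show -(q ^ (s + 2) / a) * q = -(q ^ (s + 1 + 2) / a) by ring]; ring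
  simp only [partialThetaDiff]
  rw [p r, p (r + 1), p' r, p' (r + 1)]
  generalize partialTheta q (-(a * q ^ (r + 1 + 1 + 1))) = A
  generalize partialTheta q (-(q ^ (r + 1 + 1 + 2) / a)) = B
  field_simp
  ring

theorem gammaSeq_eq {q a : ℂ} (hq : ‖q‖ < 1) (hq0 : q ≠ 0) (ha : a ≠ 0)
    (haq : ∀ m : ℤ, a ≠ q ^ m) (r : ℕ) :
    (1 - q ^ (2 * r + 1)) * gammaSeq a q r * qPochInf₃ q a (q / a) q = partialThetaDiff a q r := by
  have hθ : qPochInf₃ q a (q / a) q ≠ 0 :=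
    mul_ne_zero (mul_ne_zero (qPochInf_self_ne_zero hq)
      (qPochInf_ne_zero hq (mul_pow_ne_one_of_ne_zpow haq)))
      (qPochInf_ne_zero hq (div_mul_pow_ne_one_of_ne_zpow ha haq))
  obtain ⟨C, hC⟩ := exists_norm_gammaSeq_le hq ha haq
  obtain ⟨C', hC'⟩ := exists_norm_partialThetaDiff_le hq a
  refine sub_eq_zero.mp (eq_zero_of_recurrence (c := a + 1 / a) hq
    (D := fun r => (1 - q ^ (2 * r + 1)) * gammaSeq a q r * qPochInf₃ q a (q / a) q
      - partialThetaDiff a q r)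
    (C := 2 * C * ‖qPochInf₃ q a (q / a) q‖ + C') (fun r => ?_) (fun r => ?_) r)
  · refine (norm_sub_le _ _).trans ?_
    rw [norm_mul, norm_mul]
    have h1 : ‖1 - q ^ (2 * r + 1)‖ ≤ 2 := by
      refine (norm_sub_le _ _).trans ?_
      rw [norm_one, norm_pow]
      linarith [pow_le_one₀ (n := 2 * r + 1) (norm_nonneg q) hq.le]
    gcongr
    exacts [hC r, hC' r]
  · have h1 := gammaSeq_recurrence hq hq0 ha haq r
    rw [eq_div_iff hθ] at h1
    linear_combination h1 - partialThetaDiff_recurrence hq ha r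

/-! ### Pairing the Bailey pair with the conjugate sequence. -/

/-- The Bailey coefficient `(-1)^r q^{k r(r+1) + r(r-1)/2}`. -/
noncomputable def alphaSeq (k : ℕ) (q : ℂ) (r : ℕ) : ℂ :=
  (-1) ^ r * q ^ (k * (r * (r + 1)) + r.choose 2)

theorem hasSum_deltaSeq_mul_baileyBeta {q a : ℂ} (hq : ‖q‖ < 1) (hq0 : q ≠ 0) (ha : a ≠ 0)
    (haq : ∀ m : ℤ, a ≠ q ^ m) (k : ℕ) :
    HasSum (fun n => q ^ n * deltaSeq a q n * baileyBeta k q n)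
      ((∑' r, alphaSeq k q r * partialThetaDiff a q r) / qPochInf₃ q a (q / a) q) := by
  have hθ : qPochInf₃ q a (q / a) q ≠ 0 :=
    mul_ne_zero (mul_ne_zero (qPochInf_self_ne_zero hq)
      (qPochInf_ne_zero hq (mul_pow_ne_one_of_ne_zpow haq)))
      (qPochInf_ne_zero hq (div_mul_pow_ne_one_of_ne_zpow ha haq))
  obtain ⟨C, hC0, hC⟩ := exists_norm_gammaTerm_le hq ha haq
  let g : ℕ × ℕ → ℂ := fun p =>
    alphaSeq k q p.1 * (1 - q ^ (2 * p.1 + 1)) * gammaTerm a q p.1 p.2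
  have hle : ∀ n, ‖q‖ ^ n ≤ 1 := fun n => pow_le_one₀ (norm_nonneg q) hq.le
  have hg : Summable g := by
    -- The majorant is a constant times `|q|^{r(r-1)/2} |q|^n`; the bound on `gammaTerm` is uniform
    -- in `r`, which justifies exchanging the sums.
    have hs := (summable_pow_mul_pow_choose hq 1).mul_of_nonneg
      (summable_geometric_of_lt_one (norm_nonneg q) hq) (fun _ => norm_nonneg _)
      (fun _ => by positivity)
    refine Summable.of_norm_bounded (hs.mul_left (2 * C)) fun p => ?_
    have h1 : ‖1 - q ^ (2 * p.1 + 1)‖ ≤ 2 := by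
      refine (norm_sub_le _ _).trans ?_
      rw [norm_one, norm_pow]
      linarith [hle (2 * p.1 + 1)]
    have h2 : ‖alphaSeq k q p.1‖ ≤ ‖(1 : ℂ) ^ p.1 * q ^ p.1.choose 2‖ := by
      simp only [alphaSeq, norm_mul, norm_pow, norm_neg, norm_one, one_pow, one_mul, pow_add]
      exact mul_le_of_le_one_left (by positivity) (hle _)
    simp only [g, norm_mul _ (gammaTerm _ _ _ _), norm_mul _ (1 - _ : ℂ)]
    calc _ ≤ ‖(1 : ℂ) ^ p.1 * q ^ p.1.choose 2‖ * 2 * (C * ‖q‖ ^ p.2) := by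
          gcongr
          exact hC _ _
      _ = _ := by ring
  have hcol : ∀ n, ∑' r, g (r, n) = q ^ n * deltaSeq a q n * baileyBeta k q n := by
    intro n
    rw [tsum_eq_sum (s := range (n + 1)), baileyBeta, mul_sum]
    · refine sum_congr rfl fun r _ => ?_
      simp only [g, gammaTerm, baileyTerm, alphaSeq]
      ring
    · intro r hr
      simp only [g, gammaTerm]
      rw [qFacInv_of_neg q (show (n : ℤ) - r < 0 by simp at hr; omega)]
      ring
  have hrow : ∀ r, ∑' n, g (r, n)
      = alphaSeq k q r * partialThetaDiff a q r / qPochInf₃ q a (q / a) q := by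
    intro r
    rw [← gammaSeq_eq hq hq0 ha haq r]
    simp only [g]
    rw [tsum_mul_left, ← gammaSeq]
    field_simp
  have hsum := hg.prod_symm.prod
  simp only [Prod.swap_prod_mk] at hsum
  simp only [hcol] at hsum
  have e : ∑' n, q ^ n * deltaSeq a q n * baileyBeta k q n
      = (∑' r, alphaSeq k q r * partialThetaDiff a q r) / qPochInf₃ q a (q / a) q := by
    rw [← tsum_div_const, ← tsum_congr hrow, ← tsum_congr hcol]
    exact Summable.tsum_comm (f := fun r n => g (r, n)) hg
  rw [← e]
  exact hsum.hasSum

/-! ### The double theta series and its residue classes. -/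

theorem two_mul_choose_two (n : ℕ) : 2 * ((n.choose 2 : ℕ) : ℤ) = n * (n - 1) := by
  rw [← triInt_natCast, two_mul_triInt]

theorem two_mul_choose_two_add (n : ℕ) : 2 * n.choose 2 + 2 * n = n * (n + 1) := by
  have := two_mul_choose_two n
  zify
  linear_combination this

theorem thetaTerm_neg {b p : ℂ} (hp : p ≠ 0) (t : ℤ) :
    thetaTerm b p (-t) = thetaTerm (p / b) p t := by
  have e : triInt (-t) = t + triInt t := by
    have h1 := two_mul_triInt (-t)
    have h2 := two_mul_triInt t
    have : 2 * triInt (-t) = 2 * (t + triInt t) := by linear_combination h1 - h2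
    omega
  rw [thetaTerm, thetaTerm, e, zpow_neg, div_zpow, zpow_add₀ hp]
  ring

theorem tsum_thetaTerm_eq_nat_add {b p : ℂ} (hp : ‖p‖ < 1) (hb : b ≠ 0) (hp0 : p ≠ 0) (c : ℤ) :
    ∑' t, thetaTerm b p t
      = ∑' m : ℕ, thetaTerm b p (m + c) + ∑' m : ℕ, thetaTerm b p (-(m + 1) + c) := by
  have h := (summable_norm_thetaTerm hp hb hp0).of_norm
  have h' : Summable fun t : ℤ => thetaTerm b p (t + c) :=
    h.comp_injective (i := fun t : ℤ => t + c) (add_left_injective c)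
  have h1 : Summable fun n : ℕ => thetaTerm b p ((n : ℤ) + c) :=
    h'.comp_injective (i := fun n : ℕ => (n : ℤ)) Nat.cast_injective
  have h2 : Summable fun n : ℕ => thetaTerm b p (-((n : ℤ) + 1) + c) :=
    h'.comp_injective (i := fun n : ℕ => -((n : ℤ) + 1)) fun x y hxy => by simpa using hxy
  have h3 : ∑' t, thetaTerm b p t = ∑' t, thetaTerm b p (t + c) :=
    ((Equiv.addRight c).tsum_eq (thetaTerm b p)).symm
  rw [h3]
  exact tsum_of_nat_of_neg_add_one (f := fun t : ℤ => thetaTerm b p (t + c)) h1 h2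

theorem tsum_thetaTerm_nat_add {b p : ℂ} (hb : b ≠ 0) (hp0 : p ≠ 0) (c : ℤ) :
    ∑' m : ℕ, thetaTerm b p (m + c) = thetaTerm b p c * partialTheta p (b * p ^ c) := by
  rw [partialTheta, ← tsum_mul_left]
  refine tsum_congr fun m => ?_
  rw [add_comm, thetaTerm_add hb hp0, thetaTerm_natCast]

/-- The `m`-th coefficient `∑_s (-a)^{m+s} q^{(m+s)(m+s-1)/2} a^{-s} q^{k s(s-1)}`. -/
noncomputable def doubleThetaSum (k : ℕ) (a q : ℂ) (m : ℕ) : ℂ :=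
  ∑' s : ℤ, thetaTerm (-a) q (m + s) * thetaTerm (1 / a) (q ^ (2 * k)) s

/-- The map `(m, s) ↦ (m + s, s)` is injective, so this is a subfamily of the product of two
absolutely convergent theta series; `k > 0` makes the second one converge. -/
theorem summable_thetaTerm_mul {k : ℕ} (hk : 0 < k) {q a : ℂ} (hq : ‖q‖ < 1) (hq0 : q ≠ 0)
    (ha : a ≠ 0) : Summable fun p : ℕ × ℤ =>
      thetaTerm (-a) q (p.1 + p.2) * thetaTerm (1 / a) (q ^ (2 * k)) p.2 := by
  have hq2 : ‖q ^ (2 * k)‖ < 1 := by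
    rw [norm_pow]; exact pow_lt_one₀ (norm_nonneg _) hq (by omega)
  have h := summable_mul_of_summable_norm (summable_norm_thetaTerm hq (neg_ne_zero.mpr ha) hq0)
    (summable_norm_thetaTerm hq2 (one_div_ne_zero ha) (pow_ne_zero _ hq0))
  refine h.comp_injective (i := fun p : ℕ × ℤ => ((p.1 : ℤ) + p.2, p.2)) ?_
  rintro ⟨m, s⟩ ⟨m', s'⟩ hms
  simp only [Prod.mk.injEq] at hms ⊢
  omega

theorem summable_doubleThetaSum {k : ℕ} (hk : 0 < k) {q a : ℂ} (hq : ‖q‖ < 1) (hq0 : q ≠ 0)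
    (ha : a ≠ 0) : Summable (doubleThetaSum k a q) :=
  (summable_thetaTerm_mul hk hq hq0 ha).prod

/-- The powers `a^s` and `a^{-s}` cancel, and the bases `q` and `q^{2k}` merge into `q^{2k+1}`. -/
theorem doubleThetaSum_eq {k : ℕ} {q a : ℂ} (hq0 : q ≠ 0)
    (ha : a ≠ 0) (m : ℕ) : doubleThetaSum k a q m = (-a) ^ m * q ^ m.choose 2
      * ∑' s : ℤ, thetaTerm (-q ^ m) (q ^ (2 * k + 1)) s := by
  rw [doubleThetaSum, ← tsum_mul_left]
  refine tsum_congr fun s => ?_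
  rw [thetaTerm_add (neg_ne_zero.mpr ha) hq0, thetaTerm_natCast, mul_assoc]
  congr 1
  rw [thetaTerm, thetaTerm, thetaTerm, zpow_natCast, mul_mul_mul_comm, ← mul_zpow, ← mul_zpow,
    ← pow_succ']
  congr 2
  field_simp

theorem tsum_thetaTerm_pow_add {κ : ℕ} {q : ℂ} (hq0 : q ≠ 0) (i n : ℕ) :
    ∑' s : ℤ, thetaTerm (-q ^ i) (q ^ κ) s = (-q ^ i) ^ n * (q ^ κ) ^ n.choose 2
      * ∑' s : ℤ, thetaTerm (-q ^ (i + κ * n)) (q ^ κ) s := by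
  rw [← tsum_mul_left, ← (Equiv.addLeft (n : ℤ)).tsum_eq]
  refine tsum_congr fun s => ?_
  rw [Equiv.coe_addLeft, thetaTerm_add (neg_ne_zero.mpr (pow_ne_zero _ hq0)) (pow_ne_zero _ hq0),
    thetaTerm_natCast, zpow_natCast, pow_add, pow_mul, neg_mul]

theorem tsum_thetaTerm_pow {κ i : ℕ} (hi : i ≤ κ) (hκ : κ ≠ 0) {q : ℂ} (hq : ‖q‖ < 1)
    (hq0 : q ≠ 0) : ∑' s : ℤ, thetaTerm (-q ^ i) (q ^ κ) s
      = qPochInf₃ (q ^ i) (q ^ (κ - i)) (q ^ κ) (q ^ κ) := by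
  rw [← qPochInf₃_eq_tsum (by rw [norm_pow]; exact pow_lt_one₀ (norm_nonneg _) hq hκ)
    (pow_ne_zero _ hq0) (pow_ne_zero _ hq0), qPochInf₃, qPochInf₃, pow_sub₀ _ hq0 hi,
    div_eq_mul_inv]
  ring

/-- Quasi-periodicity (`tsum_thetaTerm_pow_add`) brings the theta argument from `q^{i+(2k+1)n}` back
to `q^i`. It absorbs the exponent `i n + (2k+1) n(n-1)/2` and the sign `(-1)^n`. -/
theorem doubleThetaSum_add_mul {k : ℕ} {q a : ℂ} (hq : ‖q‖ < 1) (hq0 : q ≠ 0)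
    (ha : a ≠ 0) {i : ℕ} (hi : i ≤ 2 * k + 1) (n : ℕ) :
    doubleThetaSum k a q (i + (2 * k + 1) * n)
      = -((-1) ^ (i + 1) * a ^ i * q ^ i.choose 2
        * qPochInf₃ (q ^ i) (q ^ (2 * k + 1 - i)) (q ^ (2 * k + 1)) (q ^ (2 * k + 1))
        * (a ^ ((2 * k + 1) * n) * q ^ (k * n * ((2 * k + 1) * n + 2 * i)))) := by
  have e : (i + (2 * k + 1) * n).choose 2
      = i.choose 2 + k * n * ((2 * k + 1) * n + 2 * i) + (i * n + (2 * k + 1) * n.choose 2) := by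
    have h1 := two_mul_choose_two (i + (2 * k + 1) * n)
    have h2 := two_mul_choose_two i
    have h3 := two_mul_choose_two n
    apply Nat.eq_of_mul_eq_mul_left two_pos
    zify
    push_cast at h1
    linear_combination h1 - h2 - (2 * k + 1 : ℤ) * h3
  have hs : (-1 : ℂ) ^ ((2 * k + 1) * n) = (-1) ^ n := by rw [pow_mul, pow_succ, pow_mul]; simp
  rw [doubleThetaSum_eq hq0 ha, ← tsum_thetaTerm_pow hi (by omega) hq hq0,
    tsum_thetaTerm_pow_add hq0 i n, e]
  rw [neg_pow a, pow_add (-1 : ℂ), hs, neg_pow (q ^ i)]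
  ring

theorem tsum_doubleThetaSum {k : ℕ} (hk : 0 < k) {q a : ℂ} (hq : ‖q‖ < 1) (hq0 : q ≠ 0)
    (ha : a ≠ 0) : ∑' m, doubleThetaSum k a q m
      = -∑ i ∈ Icc 1 (2 * k), (-1) ^ (i + 1) * a ^ i * q ^ i.choose 2
        * qPochInf₃ (q ^ i) (q ^ (2 * k + 1 - i)) (q ^ (2 * k + 1)) (q ^ (2 * k + 1))
        * ∑' n : ℕ, a ^ ((2 * k + 1) * n) * q ^ (k * n * ((2 * k + 1) * n + 2 * i)) := by
  rw [Nat.sumByResidueClasses (summable_doubleThetaSum hk hq hq0 ha) (2 * k + 1)]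
  change ∑ j : Fin (2 * k + 1), ∑' m, doubleThetaSum k a q ((j : ℕ) + (2 * k + 1) * m) = _
  rw [Fin.sum_univ_eq_sum_range (fun j => ∑' m, doubleThetaSum k a q (j + (2 * k + 1) * m)),
    ← sum_neg_distrib]
  symm
  have hterm : ∀ i ≤ 2 * k, ∑' m, doubleThetaSum k a q (i + (2 * k + 1) * m)
      = -((-1) ^ (i + 1) * a ^ i * q ^ i.choose 2
        * qPochInf₃ (q ^ i) (q ^ (2 * k + 1 - i)) (q ^ (2 * k + 1)) (q ^ (2 * k + 1))
        * ∑' n : ℕ, a ^ ((2 * k + 1) * n) * q ^ (k * n * ((2 * k + 1) * n + 2 * i))) := by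
    intro i hi
    rw [← tsum_mul_left, ← tsum_neg]
    exact tsum_congr fun n => doubleThetaSum_add_mul hq hq0 ha (by omega) n
  rw [sum_congr rfl fun i hi => (hterm i (by simp at hi; omega)).symm]
  -- The residue `i = 0` drops out because its product contains `(1; q^{2k+1})_∞ = 0`.
  refine sum_subset (fun i hi => by simp at hi ⊢; omega) fun i hi hi' => ?_
  obtain rfl : i = 0 := by simp at hi hi'; omega
  have hp : ‖q ^ (2 * k + 1)‖ < 1 := by
    rw [norm_pow]; exact pow_lt_one₀ (norm_nonneg _) hq (by omega)
  rw [hterm 0 (by omega), qPochInf₃, pow_zero q, qPochInf_eq_mul hp 1 1]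
  simp [qPoch]

/-- With `τ s` the tail of `θ` over indices `≥ s`, the double series is `∑ τ(s) F(s)` over all
integers `s`, and `F(-n) = a^n q^{kn(n+1)}`. Subtracting it from `θ ∑ F(-n)` turns the terms `s = -n
≤ 0` into lower tails and leaves the upper tails at `s = n + 1` with a minus sign. These are the two
halves of `partialThetaDiff`. -/
theorem tsum_mul_sub_tsum_doubleThetaSum {k : ℕ} (hk : 0 < k) {q a : ℂ} (hq : ‖q‖ < 1)
    (hq0 : q ≠ 0) (ha : a ≠ 0) :
    (∑' n : ℕ, a ^ n * q ^ (k * n * (n + 1))) * qPochInf₃ q a (q / a) q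
      - ∑' m, doubleThetaSum k a q m = ∑' r, alphaSeq k q r * partialThetaDiff a q r := by
  have hna : -a ≠ 0 := neg_ne_zero.mpr ha
  have hp0 : q ^ (2 * k) ≠ 0 := pow_ne_zero _ hq0
  have hp : ‖q ^ (2 * k)‖ < 1 := by
    rw [norm_pow]; exact pow_lt_one₀ (norm_nonneg _) hq (by omega)
  let F : ℤ → ℂ := thetaTerm (1 / a) (q ^ (2 * k))
  let τ : ℤ → ℂ := fun s => ∑' m : ℕ, thetaTerm (-a) q (m + s)
  have hs := summable_thetaTerm_mul hk hq hq0 ha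
  have hswap : ∑' m, doubleThetaSum k a q m = ∑' s : ℤ, τ s * F s := by
    simp only [doubleThetaSum, τ, F, ← tsum_mul_right]
    exact (Summable.tsum_comm (f := fun (m : ℕ) (s : ℤ) =>
      thetaTerm (-a) q (m + s) * thetaTerm (1 / a) (q ^ (2 * k)) s) hs).symm
  have hτ : Summable fun s : ℤ => τ s * F s := by
    have := hs.prod_symm.prod
    simpa only [Prod.swap_prod_mk, tsum_mul_right] using this
  have hτ' : Summable fun s : ℤ => τ (s + 1) * F (s + 1) :=
    (Equiv.addRight (1 : ℤ)).summable_iff.mpr hτ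
  have hτ1 : Summable fun n : ℕ => τ (n + 1) * F (n + 1) :=
    hτ'.comp_injective (i := fun n : ℕ => (n : ℤ)) Nat.cast_injective
  have hτ2 : Summable fun n : ℕ => τ (-n) * F (-n) :=
    hτ.comp_injective (i := fun n : ℕ => (-n : ℤ)) fun x y hxy => by simpa using hxy
  have hsplit : ∑' s : ℤ, τ s * F s
      = ∑' n : ℕ, τ (n + 1) * F (n + 1) + ∑' n : ℕ, τ (-n) * F (-n) := by
    have e : ∀ n : ℕ, -((n : ℤ) + 1) + 1 = -n := fun n => by ring
    -- The shift by one makes the cut fall between `s ≤ 0` and `s ≥ 1`.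
    rw [← (Equiv.addRight (1 : ℤ)).tsum_eq]
    simp only [Equiv.coe_addRight]
    have h := tsum_of_nat_of_neg_add_one (f := fun s : ℤ => τ (s + 1) * F (s + 1)) hτ1
      (by simpa only [e] using hτ2)
    simpa only [e] using h
  have hF1 : ∀ n : ℕ, F (-n) = a ^ n * q ^ (k * n * (n + 1)) := by
    intro n
    simp only [F]
    rw [thetaTerm_neg hp0, thetaTerm_natCast, ← pow_mul, div_div_eq_mul_div, div_one, mul_pow,
      ← pow_mul, mul_comm _ (a ^ n), mul_assoc, ← pow_add]
    congr 2
    linear_combination k * two_mul_choose_two_add n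
  have hF2 : ∀ n : ℕ, F (n + 1) = (1 / a) ^ (n + 1) * q ^ (k * n * (n + 1)) := by
    intro n
    simp only [F]
    have := thetaTerm_natCast (1 / a) (q ^ (2 * k)) (n + 1)
    rw [Nat.cast_add_one] at this
    rw [this, ← pow_mul, Nat.choose_succ_succ' n 1, Nat.choose_one_right]
    congr 2
    linear_combination k * two_mul_choose_two_add n
  have hFs : Summable fun n : ℕ => F (-n) :=
    (summable_norm_thetaTerm hp (one_div_ne_zero ha) hp0).of_norm.comp_injective
      (i := fun n : ℕ => (-n : ℤ)) fun x y hxy => by simpa using hxy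
  have h1 : ∀ n : ℕ, τ (n + 1) * F (n + 1)
      = -(alphaSeq k q n * (q ^ n * partialTheta q (-(a * q ^ (n + 1))))) := by
    intro n
    simp only [τ]
    rw [hF2, tsum_thetaTerm_nat_add hna hq0, alphaSeq]
    have := thetaTerm_natCast (-a) q (n + 1)
    rw [Nat.cast_add_one] at this
    rw [this, Nat.choose_succ_succ' n 1, Nat.choose_one_right, neg_mul,
      show q ^ ((n : ℤ) + 1) = q ^ (n + 1) by rw [← zpow_natCast]; push_cast; rfl, neg_pow a,
      one_div, inv_pow]
    have := pow_ne_zero (n + 1) ha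
    generalize partialTheta q (-(a * q ^ (n + 1))) = P
    field_simp
    ring
  have h2 : ∀ n : ℕ, (∑' t, thetaTerm (-a) q t - τ (-n)) * F (-n)
      = -(alphaSeq k q n * (q ^ (2 * n + 1) / a * partialTheta q (-(q ^ (n + 2) / a)))) := by
    intro n
    have hσ : ∑' m : ℕ, thetaTerm (-a) q (-(m + 1) + -n)
        = q / -a * ((q ^ 2 / -a) ^ n * q ^ n.choose 2 * partialTheta q (-(q ^ (n + 2) / a))) := by
      have e : ∀ m : ℕ, thetaTerm (-a) q (-(m + 1) + -n)
          = q / -a * thetaTerm (q ^ 2 / -a) q (m + n) := fun m => by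
        rw [← thetaTerm_neg_sub_one hna hq0]; congr 1; ring
      have e' : -(q ^ (n + 2) / a) = q ^ 2 / -a * q ^ n := by rw [pow_add, div_neg]; ring
      simp only [e]
      rw [e', tsum_mul_left, tsum_thetaTerm_nat_add (div_ne_zero (pow_ne_zero _ hq0) hna) hq0,
        thetaTerm_natCast, zpow_natCast]
    rw [tsum_thetaTerm_eq_nat_add hq hna hq0 (-n)]
    simp only [τ]
    rw [add_sub_cancel_left, hσ, hF1, alphaSeq]
    generalize partialTheta q (-(q ^ (n + 2) / a)) = P
    rw [div_neg, div_neg, neg_pow, div_pow]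
    have := pow_ne_zero n ha
    field_simp
    ring
  rw [qPochInf₃_eq_tsum hq hq0 ha, hswap, hsplit, ← tsum_mul_right, ← sub_sub, sub_right_comm,
    ← Summable.tsum_sub, ← Summable.tsum_sub]
  · refine tsum_congr fun n => ?_
    rw [← hF1, partialThetaDiff]
    linear_combination h2 n - h1 n
  · refine Summable.sub ?_ hτ2
    simpa only [hF1] using hFs.mul_right (∑' t, thetaTerm (-a) q t)
  · exact hτ1
  · simpa only [hF1] using hFs.mul_right (∑' t, thetaTerm (-a) q t)
  · exact hτ2

/-! ### Summability of the right side and the identity for `q ≠ 0`. -/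

theorem summable_pow_mul_pow_theta {q : ℂ} (hq : ‖q‖ < 1) (a : ℂ) {k : ℕ} (hk : 0 < k) :
    Summable fun n : ℕ => a ^ n * q ^ (k * n * (n + 1)) := by
  have hp : ‖q ^ (2 * k)‖ < 1 := by
    rw [norm_pow]; exact pow_lt_one₀ (norm_nonneg _) hq (by omega)
  refine (summable_pow_mul_pow_choose hp (a * q ^ (2 * k))).of_norm.congr fun n => ?_
  rw [mul_pow, ← pow_mul, ← pow_mul, mul_assoc, ← pow_add]
  congr 2
  linear_combination k * two_mul_choose_two_add n

theorem summable_pow_mul_pow_residue {q : ℂ} (hq : ‖q‖ < 1) (a : ℂ) {k κ : ℕ} (hk : 0 < k)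
    (hκ : 0 < κ) (i : ℕ) :
    Summable fun n : ℕ => a ^ (κ * n) * q ^ (k * n * (κ * n + 2 * i)) := by
  have hp : ‖q ^ (2 * k * κ)‖ < 1 := by
    rw [norm_pow]; exact pow_lt_one₀ (norm_nonneg _) hq (by positivity)
  refine (summable_pow_mul_pow_choose hp (a ^ κ * q ^ (k * κ + 2 * k * i))).of_norm.congr
    fun n => ?_
  rw [mul_pow, ← pow_mul, ← pow_mul, ← pow_mul, mul_assoc, ← pow_add]
  congr 2
  have h := two_mul_choose_two n
  zify
  linear_combination (k * κ : ℤ) * h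

theorem hasSum_multisum {q a : ℂ} (hq : ‖q‖ < 1) (hq0 : q ≠ 0) (ha : a ≠ 0)
    (haq : ∀ m : ℤ, a ≠ q ^ m) {k : ℕ} (hk : 0 < k) :
    HasSum (fun n : ℕ => qPoch q q (2 * n) * q ^ n / (qPoch a q (n + 1) * qPoch (q / a) q n)
        * ∑' ν : Fin (k - 1) → ℕ, multisumTerm k q n ν)
      ((∑' n : ℕ, a ^ n * q ^ (k * n * (n + 1)))
        + ∑ i ∈ Icc 1 (2 * k), (-1) ^ (i + 1) * a ^ i * q ^ (i.choose 2)
          * (qPochInf₃ (q ^ i) (q ^ (2 * k + 1 - i)) (q ^ (2 * k + 1)) (q ^ (2 * k + 1))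
            / qPochInf₃ q a (q / a) q)
          * ∑' n : ℕ, a ^ ((2 * k + 1) * n) * q ^ (k * n * ((2 * k + 1) * n + 2 * i))) := by
  have hθ : qPochInf₃ q a (q / a) q ≠ 0 :=
    mul_ne_zero (mul_ne_zero (qPochInf_self_ne_zero hq)
      (qPochInf_ne_zero hq (mul_pow_ne_one_of_ne_zpow haq)))
      (qPochInf_ne_zero hq (div_mul_pow_ne_one_of_ne_zpow ha haq))
  obtain ⟨m, rfl⟩ : ∃ m, k = m + 1 := ⟨k - 1, by omega⟩
  convert hasSum_deltaSeq_mul_baileyBeta hq hq0 ha haq (m + 1) using 1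
  · funext n
    rw [tsum_multisumTerm hq hq0, deltaSeq]
    ring
  · rw [← tsum_mul_sub_tsum_doubleThetaSum hk hq hq0 ha, tsum_doubleThetaSum hk hq hq0 ha,
      eq_div_iff hθ, add_mul, sub_neg_eq_add, sum_mul]
    congr 1
    refine sum_congr rfl fun i _ => ?_
    field_simp

/-! ### The degenerate case `q = 0`. -/

theorem qPochInf_zero_left (q : ℂ) : qPochInf 0 q = 1 := by simp [qPochInf]

theorem qPochInf_zero_right (a : ℂ) : qPochInf a 0 = 1 - a := by
  rw [qPochInf_eq_mul (by simp) a 1]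
  simp [qPoch, qPochInf_zero_left]

theorem tsum_multisumTerm_zero_zero (k : ℕ) : ∑' ν, multisumTerm k 0 0 ν = 1 := by
  rw [tsum_eq_single 0]
  · simp [multisumTerm, tailSum, qFacInv_zero, qPoch_zero]
  · intro ν hν
    obtain ⟨i, hi⟩ := Function.ne_iff.mp hν
    exact multisumTerm_eq_zero _ ((Nat.pos_of_ne_zero hi).trans_le (le_tailSum_zero ν i))

/-- With `0^0 = 1`, only `n = 0` and `i = 1` survive, and the identity becomes `1/(1-a) = 1 +
a/(1-a)`. -/
theorem hasSum_multisum_zero {a : ℂ} (ha1 : a ≠ 1) {k : ℕ} (hk : 0 < k) :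
    HasSum (fun n : ℕ => qPoch 0 0 (2 * n) * 0 ^ n / (qPoch a 0 (n + 1) * qPoch (0 / a) 0 n)
        * ∑' ν : Fin (k - 1) → ℕ, multisumTerm k 0 n ν)
      ((∑' n : ℕ, a ^ n * 0 ^ (k * n * (n + 1)))
        + ∑ i ∈ Icc 1 (2 * k), (-1) ^ (i + 1) * a ^ i * 0 ^ (i.choose 2)
          * (qPochInf₃ (0 ^ i) (0 ^ (2 * k + 1 - i)) (0 ^ (2 * k + 1)) (0 ^ (2 * k + 1))
            / qPochInf₃ 0 a (0 / a) 0)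
          * ∑' n : ℕ, a ^ ((2 * k + 1) * n) * 0 ^ (k * n * ((2 * k + 1) * n + 2 * i))) := by
  have h1 : 1 - a ≠ 0 := sub_ne_zero.mpr ha1.symm
  have e1 : ∑' n : ℕ, a ^ n * (0 : ℂ) ^ (k * n * (n + 1)) = 1 := by
    rw [tsum_eq_single 0 fun n hn => by rw [zero_pow (by positivity), mul_zero]]
    simp
  have e2 : ∑' n : ℕ, a ^ ((2 * k + 1) * n) * (0 : ℂ) ^ (k * n * ((2 * k + 1) * n + 2 * 1)) = 1 := by
    rw [tsum_eq_single 0 fun n hn => by rw [zero_pow (by positivity), mul_zero]]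
    simp
  rw [e1, sum_eq_single_of_mem 1 (by simp; omega), e2]
  · have hk' : 2 * k ≠ 0 := by omega
    convert hasSum_single (0 : ℕ) fun n hn => ?_ using 1
    · rw [tsum_multisumTerm_zero_zero]
      simp [qPochInf₃, qPochInf_zero_right, qPoch, hk']
      field_simp
      ring
    · simp [zero_pow hn]
  · intro i hi hi1
    have : i.choose 2 ≠ 0 := (Nat.choose_pos (by simp at hi; omega)).ne'
    rw [zero_pow this]
    ring

/-! ### Ramanujan's case `k = 1` and the conclusion. -/

/-- `(q, q², q³; q³)_∞ = (q; q)_∞`. -/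
theorem qPochInf₃_cube {q : ℂ} (hq : ‖q‖ < 1) :
    qPochInf₃ (q ^ 1) (q ^ 2) (q ^ 3) (q ^ 3) = qPochInf q q := by
  have hp : ‖q ^ 3‖ < 1 := by
    rw [norm_pow]; exact pow_lt_one₀ (norm_nonneg _) hq (by omega)
  have h1 : Tendsto (fun n => qPoch q q (3 * n)) atTop (𝓝 (qPochInf q q)) :=
    (tendsto_qPoch hq q).comp (tendsto_id.const_mul_atTop' three_pos)
  refine tendsto_nhds_unique ((((tendsto_qPoch hp (q ^ 1)).mul (tendsto_qPoch hp (q ^ 2))).mul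
    (tendsto_qPoch hp (q ^ 3))).congr fun n => ?_) h1
  induction n with
  | zero => simp [qPoch_zero]
  | succ n ih =>
    rw [show 3 * (n + 1) = 3 * n + 1 + 1 + 1 by ring]
    simp only [qPoch_succ _ q, ← ih, qPoch_succ _ (q ^ 3)]
    ring

theorem qPoch_pow_succ_mul (q : ℂ) (n : ℕ) :
    qPoch q q n * qPoch (q ^ (n + 1)) q n = qPoch q q (2 * n) := by
  rw [two_mul, qPoch, qPoch, qPoch, prod_range_add]
  congr 1
  exact prod_congr rfl fun j _ => by ring

theorem multisum_identity (q a : ℂ) (hq : ‖q‖ < 1) (ha : a ≠ 0) (haq : ∀ m : ℤ, a ≠ q ^ m)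
    {k : ℕ} (hk : 0 < k) :
    HasSum (fun n : ℕ => qPoch q q (2 * n) * q ^ n / (qPoch a q (n + 1) * qPoch (q / a) q n)
        * ∑' ν : Fin (k - 1) → ℕ, multisumTerm k q n ν)
      ((∑' n : ℕ, a ^ n * q ^ (k * n * (n + 1)))
        + ∑ i ∈ Icc 1 (2 * k), (-1) ^ (i + 1) * a ^ i * q ^ (i.choose 2)
          * (qPochInf₃ (q ^ i) (q ^ (2 * k + 1 - i)) (q ^ (2 * k + 1)) (q ^ (2 * k + 1))
            / qPochInf₃ q a (q / a) q)
          * ∑' n : ℕ, a ^ ((2 * k + 1) * n) * q ^ (k * n * ((2 * k + 1) * n + 2 * i))) := by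
  rcases eq_or_ne q 0 with rfl | hq0
  · exact hasSum_multisum_zero (by simpa using haq 0) hk
  · exact hasSum_multisum hq hq0 ha haq hk

theorem tsum_multisumTerm_one (q : ℂ) (n : ℕ) :
    ∑' ν : Fin (1 - 1) → ℕ, multisumTerm 1 q n ν = 1 / qPoch q q n := by
  change ∑' ν : Fin 0 → ℕ, multisumTerm 1 q n ν = _
  rw [tsum_fintype]
  simp [multisumTerm, tailSum, qFacInv_natCast]

theorem theoremT1 (q a : ℂ) (hq : ‖q‖ < 1) (ha : a ≠ 0) (haq : ∀ m : ℤ, a ≠ q ^ m) :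
    (∀ k : ℕ, 0 < k → ∀ κ : ℕ, κ = 2 * k + 1 →
      (∀ n : ℕ, Summable (multisumTerm k q n)) ∧
      Summable (fun n : ℕ => qPoch q q (2 * n) * q ^ n / (qPoch a q (n + 1) * qPoch (q / a) q n)
        * ∑' ν : Fin (k - 1) → ℕ, multisumTerm k q n ν) ∧
      Summable (fun n : ℕ => a ^ n * q ^ (k * n * (n + 1))) ∧
      (∀ i ∈ Finset.Icc 1 (κ - 1),
        Summable (fun n : ℕ => a ^ (κ * n) * q ^ (k * n * (κ * n + 2 * i)))) ∧
      (∑' n : ℕ, qPoch q q (2 * n) * q ^ n / (qPoch a q (n + 1) * qPoch (q / a) q n)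
          * ∑' ν : Fin (k - 1) → ℕ, multisumTerm k q n ν)
        = (∑' n : ℕ, a ^ n * q ^ (k * n * (n + 1)))
          + ∑ i ∈ Finset.Icc 1 (κ - 1), (-1) ^ (i + 1) * a ^ i * q ^ (i.choose 2)
              * (qPochInf₃ (q ^ i) (q ^ (κ - i)) (q ^ κ) (q ^ κ) / qPochInf₃ q a (q / a) q)
              * ∑' n : ℕ, a ^ (κ * n) * q ^ (k * n * (κ * n + 2 * i))) ∧
    (Summable (fun n : ℕ => qPoch (q ^ (n + 1)) q n * q ^ n
        / (qPoch a q (n + 1) * qPoch (q / a) q n)) ∧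
      Summable (fun n : ℕ => a ^ n * q ^ (n * (n + 1))) ∧
      Summable (fun n : ℕ => a ^ (3 * n + 1) * q ^ (n * (3 * n + 2)) * (1 - a * q ^ (2 * n + 1))
        / (qPochInf a q * qPochInf (q / a) q)) ∧
      (∑' n : ℕ, qPoch (q ^ (n + 1)) q n * q ^ n / (qPoch a q (n + 1) * qPoch (q / a) q n))
        = (∑' n : ℕ, a ^ n * q ^ (n * (n + 1)))
          + ∑' n : ℕ, a ^ (3 * n + 1) * q ^ (n * (3 * n + 2)) * (1 - a * q ^ (2 * n + 1))
              / (qPochInf a q * qPochInf (q / a) q)) := by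
  refine ⟨?_, ?_⟩
  · rintro k hk κ rfl
    have h := multisum_identity q a hq ha haq hk
    exact ⟨summable_multisumTerm k q, h.summable, summable_pow_mul_pow_theta hq a hk,
      fun i _ => summable_pow_mul_pow_residue hq a hk (Nat.succ_pos _) i, h.tsum_eq⟩
  · have hqq := qPochInf_self_ne_zero hq
    have hterm : ∀ n : ℕ, qPoch q q (2 * n) * q ^ n / (qPoch a q (n + 1) * qPoch (q / a) q n)
        * ∑' ν : Fin (1 - 1) → ℕ, multisumTerm 1 q n ν
        = qPoch (q ^ (n + 1)) q n * q ^ n / (qPoch a q (n + 1) * qPoch (q / a) q n) := by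
      intro n
      have := qPoch_self_ne_zero hq n
      rw [tsum_multisumTerm_one, ← qPoch_pow_succ_mul]
      field_simp
    have h := multisum_identity q a hq ha haq one_pos
    simp only [hterm] at h
    have s1 : Summable fun n : ℕ => a ^ n * q ^ (n * (n + 1)) := by
      simpa only [one_mul] using summable_pow_mul_pow_theta hq a one_pos
    have r := fun i => summable_pow_mul_pow_residue hq a one_pos (show 0 < 2 * 1 + 1 by omega) i
    -- The two terms of `1 - a q^{2n+1}` are the contributions of `i = 1` and `i = 2`; both theta
    -- products equal `(q;q)_∞` and cancel that factor of the denominator.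
    have s2 : ∀ n : ℕ, a ^ (3 * n + 1) * q ^ (n * (3 * n + 2)) * (1 - a * q ^ (2 * n + 1))
          / (qPochInf a q * qPochInf (q / a) q)
        = a / (qPochInf a q * qPochInf (q / a) q)
            * (a ^ ((2 * 1 + 1) * n) * q ^ (1 * n * ((2 * 1 + 1) * n + 2 * 1)))
          - a ^ 2 * q / (qPochInf a q * qPochInf (q / a) q)
            * (a ^ ((2 * 1 + 1) * n) * q ^ (1 * n * ((2 * 1 + 1) * n + 2 * 2))) := by
      intro n
      ring
    have s3 := ((r 1).mul_left (a / (qPochInf a q * qPochInf (q / a) q))).hasSum.sub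
      ((r 2).mul_left (a ^ 2 * q / (qPochInf a q * qPochInf (q / a) q))).hasSum
    simp only [← s2] at s3
    refine ⟨h.summable, s1, s3.summable, ?_⟩
    rw [h.tsum_eq, s3.tsum_eq, tsum_mul_left, tsum_mul_left,
      show Icc 1 (2 * 1) = {1, 2} by rfl, sum_pair (by norm_num)]
    have c1 := qPochInf₃_cube hq
    have c2 : qPochInf₃ (q ^ 2) (q ^ 1) (q ^ 3) (q ^ 3) = qPochInf q q := by
      rw [← c1, qPochInf₃, qPochInf₃]; ring
    have hd : qPochInf q q / qPochInf₃ q a (q / a) q = 1 / (qPochInf a q * qPochInf (q / a) q) := by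
      rw [qPochInf₃, mul_assoc, div_mul_eq_div_div, div_self hqq]
    simp only [show 2 * 1 + 1 - 1 = 2 by rfl, show 2 * 1 + 1 - 2 = 1 by rfl,
      show 2 * 1 + 1 = 3 by rfl, c1, c2, hd, one_mul, Nat.choose_self,
      show Nat.choose 1 2 = 0 by rfl]
    ring
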